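/- Let $P$ be a convex polygon in the Euclidean plane with perimeter $L$, and let $s\in[0,L]$ be the arc length parameter of its boundary $\partial P$. The slap map $\psi_P$ of $P$ sends $s$ (for every point other than a vertex) to $s'$, where $s'$ is the point of $\partial P$, other than $s$, that is closest to $s$ on the ray starting at $s$, orthogonal to the side containing $s$ and directed inside $P$. (The values at the vertices are irrelevant: they form a finite set.) An acip of $\psi_P$ is a $\psi_P$-invariant Borel probability measure that is absolutely continuous with respect to the Lebesgue measure of $[0,L]$. An ergodic acip $\mu$ has mixing period $k\ge 1$ if its support is a disjoint union of $k$ measurable sets $\Sigma_1,\dots,\Sigma_k$ that $\psi_P$ permutes cyclically (up to $\mu$-null sets) and, for each $j$, the restriction of $\psi_P^{k}$ to $\Sigma_j$ is exact with respect to $\mu|_{\Sigma_j}$. For every integer $n\ge 2$ there exists a convex $3n$-gon $P$ (that is, a convex polygon with exactly $3n$ sides) such that $\psi_P$ has exactly $n$ ergodic acips, and each of them has an even mixing period. -/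

import Mathlib

open MeasureTheory Set

noncomputable section

namespace SlapMap

/-- The Euclidean plane. -/
abbrev Plane : Type := EuclideanSpace ℝ (Fin 2)

/-- The planar cross product (determinant) of two vectors. -/
def cross (u v : Plane) : ℝ := u 0 * v 1 - u 1 * v 0

/-- Counterclockwise rotation by a right angle. -/
def rotLeft (u : Plane) : Plane := !₂[-u 1, u 0]

/-- A convex `d`-gon, its vertices listed in counterclockwise order: `d ≥ 3`, and every vertex that
is not an endpoint of a given side lies strictly to the left of the line through that side,
directed from the vertex `i` to the next one. (In particular the polygon does not
intersect itself and no three vertices are collinear, so it has exactly `d` sides.) -/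
def IsConvexPolygon {d : ℕ} (P : Polygon Plane d) : Prop :=
  3 ≤ d ∧ ∀ i j : Fin d, j ≠ i → j ≠ finRotate d i →
    0 < cross (P.vertices (finRotate d i) - P.vertices i) (P.vertices j - P.vertices i)

variable {d : ℕ} (P : Polygon Plane d)

/-- The length of the side from the vertex `i` to the next vertex. -/
def sideLength (i : Fin d) : ℝ := dist (P.vertices i) (P.vertices (finRotate d i))

/-- The perimeter `L`. -/
def perimeter : ℝ := ∑ i, sideLength P i

/-- The arc length parameter of the vertex `i`, measured from the vertex `0`. -/
def sideStart (i : Fin d) : ℝ := ∑ j ∈ Finset.Iio i, sideLength P j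

/-- The arc length parameters of the points of side `i` (its first endpoint included, its last
endpoint not). These intervals partition `[0, L)`. -/
def sideInterval (i : Fin d) : Set ℝ := Ico (sideStart P i) (sideStart P i + sideLength P i)

/-- The unit direction vector of the side `i`. -/
def sideDir (i : Fin d) : Plane :=
  (sideLength P i)⁻¹ • (P.vertices (finRotate d i) - P.vertices i)

/-- The unit normal of the side `i`, on its left: for a convex polygon with vertices in
counterclockwise order it points inside the polygon. -/
def inwardNormal (i : Fin d) : Plane := rotLeft (sideDir P i)

/-- The point of the side `i` with arc length parameter `s`. -/
def sidePoint (i : Fin d) (s : ℝ) : Plane :=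
  P.vertices i + (s - sideStart P i) • sideDir P i

/-- `s'` is the image of `s` under the slap map: the point of the boundary with arc length
parameter `s'` lies on the ray that starts at the point with parameter `s` and is directed inside
the polygon, orthogonally to the side of `s`, and no point of the boundary on this
ray is closer to the starting point (which itself is not counted). -/
def IsSlapImage (s s' : ℝ) : Prop :=
  ∃ i j : Fin d, s ∈ sideInterval P i ∧ s' ∈ sideInterval P j ∧
    ∃ t : ℝ, 0 < t ∧ sidePoint P j s' = sidePoint P i s + t • inwardNormal P i ∧
      ∀ r ∈ Ioo 0 t, sidePoint P i s + r • inwardNormal P i ∉ P.boundary ℝ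

open Classical in
/-- The slap map in the arc length parameter. At every interior point of a side of a convex polygon
the image exists and is unique. The map is extended by `0` to the parameters with no
image: those outside `[0, L)`, and possibly some of the finitely many vertices. -/
def slapMap (s : ℝ) : ℝ :=
  if h : ∃ s', IsSlapImage P s s' then h.choose else 0

/-- `μ` is an ergodic acip of the slap map: an ergodic invariant probability measure, absolutely
continuous with respect to the Lebesgue measure of the interval `[0, L]`. -/
structure IsErgodicAcip (μ : Measure ℝ) : Prop where
  isProbabilityMeasure : IsProbabilityMeasure μ
  absolutelyContinuous : μ ≪ volume.restrict (Icc 0 (perimeter P))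
  ergodic : Ergodic (slapMap P) μ

/-- The system `(g, μ)` is exact: `g` preserves `μ` and the tail σ-algebra
`⋂ m, g⁻ᵐ(Borel sets)` is trivial modulo `μ`. -/
structure IsExact (g : ℝ → ℝ) (μ : Measure ℝ) : Prop where
  measurePreserving : MeasurePreserving g μ μ
  tail_trivial : ∀ A : Set ℝ, (∀ m : ℕ, ∃ B : Set ℝ, MeasurableSet B ∧ A = g^[m] ⁻¹' B) →
    μ A = 0 ∨ μ Aᶜ = 0

/-- `(f, μ)` has mixing period `k`: the support of `μ` is the union of `k ≥ 1` disjoint measurable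
sets (the mixing components) that `f` permutes cyclically (modulo `μ`-null sets), and the
restriction of `f^k` to each of them is exact for the restriction of `μ`. -/
def HasMixingPeriod (f : ℝ → ℝ) (μ : Measure ℝ) (k : ℕ) : Prop :=
  1 ≤ k ∧ ∃ C : Fin k → Set ℝ,
    (∀ j, MeasurableSet (C j)) ∧
    Pairwise (fun i j => Disjoint (C i) (C j)) ∧
    (⋃ j, C j) = μ.support ∧
    (∀ j, f ⁻¹' (C (finRotate k j)) =ᵐ[μ] C j) ∧
    (∀ j, IsExact f^[k] (μ.restrict (C j)))

end SlapMap

end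

namespace SlapMap

open Function Filter
open scoped ENNReal Pointwise

/-! The polygon is a regular `2n`-gon of inradius one in which `n` consecutive sides are kept and
each of the `n` opposite sides is replaced by a symmetric roof of two sides of small slope `t`.
Opposite sides of a regular `2n`-gon are parallel, so the slap map sends a kept side vertically onto
its roof. If `c < w`, where `c = t(2 + wt)` and `w = tan(π/2n)` is the half-length of a side, then
the normals of the roof lead back to the same kept side. In the horizontal coordinate `x` the return
is `x ↦ λx + c` for `x ≤ 0` and `x ↦ λx - c` for `x > 0`, with `λ = 1 + t²`: a symmetric Lorenz map.
The dynamics thus splits into `n` independent systems, each alternating between a kept side and its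
roof (`isLorenzSystem_slapMap`).

A symmetric Lorenz map with `λ² ≤ 2` renormalises: its second iterate on a smaller interval is the
Lorenz map of slope `λ²`, and no point of that interval returns to it after one step
(`lorenz_lorenz`, `lorenz_notMem`). The slope is chosen with `λ^(2^m) = 2`. After `m`
renormalisations the Lorenz map becomes the doubling map of the circle, so the slap map has over
each kept side a tower of height `2 * 2^m` over the doubling map (`IsLorenzSystem.isDoublingTower`).

Lebesgue measure spread over such a tower is an ergodic invariant measure. Its levels are permuted
cyclically, and exactness of the doubling map makes the tower height a mixing period, which is even
because of the factor 2. Conversely, outside countable sets of exceptional points every point is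
eventually carried into the base of some tower, so each ergodic acip charges a base
(`IsLorenzSystem.exists_measure_base_ne_zero`). Ergodicity of the doubling map then identifies it
with the measure of that tower (`IsDoublingTower.eq_towerMeasure`). Hence there are exactly `n`
ergodic acips. -/

theorem val_finRotate {d : ℕ} (i : Fin d) :
    (finRotate d i : ℕ) = if (i : ℕ) + 1 = d then 0 else (i : ℕ) + 1 := by
  obtain ⟨i, hi⟩ := i
  cases d with
  | zero => omega
  | succ d =>
    rcases Nat.lt_or_ge i d with h | h
    · rw [finRotate_of_lt h, if_neg (by simpa using h.ne)]
    · obtain rfl : i = d := by omega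
      rw [finRotate_last', if_pos rfl]

/-! ### Exactness of the doubling map of the circle -/

theorem doubling_iterate (m : ℕ) (z : UnitAddCircle) :
    (fun z : UnitAddCircle => 2 • z)^[m] z = 2 ^ m • z := by
  induction m with
  | zero => simp
  | succ m ih => rw [iterate_succ_apply', ih, ← mul_nsmul, pow_succ, mul_comm]

/-- A preimage under `z ↦ 2^m z` is invariant under translation by a point of order `2^m`. A set
invariant under translations of orders tending to infinity is null or conull. -/
theorem doubling_tail_trivial {A : Set UnitAddCircle}
    (hA : ∀ m : ℕ, ∃ B, MeasurableSet B ∧ A = (fun z : UnitAddCircle => 2 • z)^[m] ⁻¹' B) :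
    volume A = 0 ∨ volume Aᶜ = 0 := by
  have hmeas : NullMeasurableSet A volume := by
    obtain ⟨B, hB, rfl⟩ := hA 0
    exact hB.nullMeasurableSet
  let u : ℕ → UnitAddCircle := fun j => ((((1 : ℕ) : ℝ) / ((2 ^ j : ℕ) : ℝ) * 1 : ℝ) : UnitAddCircle)
  have hu₀ : ∀ j, addOrderOf (u j) = 2 ^ j := fun j =>
    AddCircle.addOrderOf_div_of_gcd_eq_one (p := (1 : ℝ)) (m := 1) (by positivity)
      (Nat.gcd_one_left _)
  have hu₁ : ∀ j, (u j +ᵥ A : Set UnitAddCircle) =ᵐ[volume] A := by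
    intro j
    obtain ⟨B, -, hB⟩ := hA j
    refine EventuallyEq.of_eq ?_
    have h0 : 2 ^ j • u j = 0 := by rw [← hu₀ j]; exact addOrderOf_nsmul_eq_zero _
    refine Set.ext fun z => ?_
    rw [Set.mem_vadd_set_iff_neg_vadd_mem, hB, mem_preimage, mem_preimage, doubling_iterate,
      doubling_iterate, vadd_eq_add, nsmul_add, neg_nsmul, h0, neg_zero, zero_add]
  have hu₂ : Tendsto (addOrderOf ∘ u) atTop atTop := by
    have : addOrderOf ∘ u = fun j => 2 ^ j := funext hu₀
    rw [this]
    exact tendsto_pow_atTop_atTop_of_one_lt (by norm_num)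
  rcases AddCircle.ae_empty_or_univ_of_forall_vadd_ae_eq_self hmeas hu₁ hu₂ with h | h
  · exact Or.inl (ae_eq_empty.1 h)
  · exact Or.inr (ae_eq_univ.1 h)

/-! ### Towers over the doubling map -/

/-- `h` conjugates the doubling map of the circle to the return map of `f` to the range of `h`, and
all points of this range return to it for the first time after `k` steps. -/
structure IsDoublingTower (f : ℝ → ℝ) (k : ℕ) (h : UnitAddCircle → ℝ) : Prop where
  pos : 0 < k
  measurable_map : Measurable f
  measurable : Measurable h
  measurableSet_range : MeasurableSet (range h)
  semiconj : ∀ z, f^[k] (h z) = h (2 • z)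
  first_return : ∀ z r, 0 < r → r < k → f^[r] (h z) ∉ range h

/-- The measure obtained by spreading the Lebesgue measure of the circle over the tower. -/
noncomputable def towerMeasure (f : ℝ → ℝ) (k : ℕ) (h : UnitAddCircle → ℝ) : Measure ℝ :=
  (k : ℝ≥0∞)⁻¹ • ∑ l ∈ Finset.range k, (volume : Measure UnitAddCircle).map (f^[l] ∘ h)

/-- The points that reach the base of the tower after `k - j` steps. -/
def towerLevel (f : ℝ → ℝ) (k : ℕ) (h : UnitAddCircle → ℝ) (j : ℕ) : Set ℝ :=
  f^[k - j] ⁻¹' range h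

namespace IsDoublingTower

variable {f : ℝ → ℝ} {k : ℕ} {h : UnitAddCircle → ℝ} (H : IsDoublingTower f k h)
include H

theorem measurable_level (l : ℕ) : Measurable (f^[l] ∘ h) :=
  (H.measurable_map.iterate l).comp H.measurable

theorem semiconj_iterate (m : ℕ) (z : UnitAddCircle) :
    (f^[k])^[m] (h z) = h ((fun z : UnitAddCircle => 2 • z)^[m] z) := by
  have : Semiconj h (fun z : UnitAddCircle => 2 • z) f^[k] := fun z => (H.semiconj z).symm
  exact ((this.iterate_right m) z).symm

theorem apply {A : Set ℝ} (hA : MeasurableSet A) :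
    towerMeasure f k h A
      = (k : ℝ≥0∞)⁻¹ * ∑ l ∈ Finset.range k, volume ((f^[l] ∘ h) ⁻¹' A) := by
  rw [towerMeasure, Measure.smul_apply, Measure.finsetSum_apply, smul_eq_mul]
  congr 1
  exact Finset.sum_congr rfl fun l _ => Measure.map_apply (H.measurable_level l) hA

theorem inv_mul_cancel : (k : ℝ≥0∞)⁻¹ * k = 1 :=
  ENNReal.inv_mul_cancel (by exact_mod_cast H.pos.ne') (ENNReal.natCast_ne_top k)

theorem isProbabilityMeasure : IsProbabilityMeasure (towerMeasure f k h) := by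
  constructor
  rw [H.apply MeasurableSet.univ]
  simp [H.inv_mul_cancel]

/-- Applying `f` shifts every level up by one; the top level falls back to the base through the
doubling map, which preserves Lebesgue measure. -/
theorem measurePreserving : MeasurePreserving f (towerMeasure f k h) (towerMeasure f k h) := by
  refine ⟨H.measurable_map, ?_⟩
  ext A hA
  rw [Measure.map_apply H.measurable_map hA, H.apply (H.measurable_map hA), H.apply hA]
  congr 1
  have hstep : ∀ l, volume ((f^[l] ∘ h) ⁻¹' (f ⁻¹' A)) = volume ((f^[l + 1] ∘ h) ⁻¹' A) := by
    intro l
    rw [← preimage_comp, ← comp_assoc, ← iterate_succ']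
  have hk : volume ((f^[k] ∘ h) ⁻¹' A) = volume ((f^[0] ∘ h) ⁻¹' A) := by
    have : f^[k] ∘ h = h ∘ fun z : UnitAddCircle => 2 • z := funext H.semiconj
    rw [this, preimage_comp, iterate_zero, id_comp]
    exact (AddCircle.ergodic_nsmul (T := (1 : ℝ)) one_lt_two).measure_preimage
      (H.measurable hA).nullMeasurableSet
  rw [Finset.sum_congr rfl fun l _ => hstep l]
  obtain ⟨k', rfl⟩ := Nat.exists_eq_succ_of_ne_zero H.pos.ne'
  rw [Finset.sum_range_succ, Finset.sum_range_succ', hk]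

theorem ae_of_forall {p : ℝ → Prop} (hp : MeasurableSet {x | p x})
    (hall : ∀ l < k, ∀ z, p (f^[l] (h z))) : ∀ᵐ x ∂(towerMeasure f k h), p x := by
  rw [ae_iff]
  have : {x | ¬ p x} = {x | p x}ᶜ := rfl
  rw [this, H.apply hp.compl]
  have h0 : ∀ l ∈ Finset.range k, volume ((f^[l] ∘ h) ⁻¹' {x | p x}ᶜ) = 0 := by
    intro l hl
    have : (f^[l] ∘ h) ⁻¹' {x | p x}ᶜ = ∅ := by
      ext z
      simpa using hall l (Finset.mem_range.1 hl) z
    rw [this, measure_empty]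
  rw [Finset.sum_eq_zero h0, mul_zero]

theorem ergodic : Ergodic f (towerMeasure f k h) := by
  refine { H.measurePreserving with aeconst_set := fun A hA hfA => ?_ }
  have hiter : ∀ l, (f^[l] ∘ h) ⁻¹' A = h ⁻¹' A := by
    intro l
    have : f^[l] ⁻¹' A = A := by
      induction l with
      | zero => rfl
      | succ l ih => rw [iterate_succ, preimage_comp, ih, hfA]
    rw [preimage_comp, this]
  -- By the semiconjugacy this preimage is that of `A` under `f^[k] ∘ h`, and `A` is `f`-invariant.
  have hd : (fun z : UnitAddCircle => 2 • z) ⁻¹' (h ⁻¹' A) = h ⁻¹' A := by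
    rw [← hiter k, ← preimage_comp]
    have : f^[k] ∘ h = h ∘ fun z : UnitAddCircle => 2 • z := funext H.semiconj
    rw [this, preimage_comp, preimage_comp, ← preimage_comp (g := h), ← this, hiter]
    conv_rhs => rw [← hiter k, this, preimage_comp]
  have hc := (AddCircle.ergodic_nsmul (T := (1 : ℝ)) one_lt_two).aeconst_set
    (H.measurable hA) hd
  rw [eventuallyConst_set'] at hc ⊢
  rcases hc with hc | hc
  · left
    rw [ae_eq_empty] at hc ⊢
    rw [H.apply hA, Finset.sum_eq_zero (fun l _ => by rw [hiter, hc]), mul_zero]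
  · right
    rw [eventuallyEq_univ, mem_ae_iff] at hc ⊢
    rw [H.apply hA.compl, Finset.sum_eq_zero, mul_zero]
    intro l _
    rw [preimage_compl, hiter, hc]

theorem measurableSet_towerLevel (j : ℕ) : MeasurableSet (towerLevel f k h j) :=
  H.measurable_map.iterate _ H.measurableSet_range

/-- An orbit starting in the base is there exactly at the multiples of `k`, and `0 < l + (k - j) < 2
* k` is one only when `l = j`. Defining levels by the time left until the return, and not as images
of the base, makes them measurable at once. -/
theorem mem_towerLevel_iff {l j : ℕ} (hl : l < k) (hj : j < k) (z : UnitAddCircle) :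
    f^[l] (h z) ∈ towerLevel f k h j ↔ l = j := by
  rw [towerLevel, mem_preimage, ← iterate_add_apply]
  rcases lt_trichotomy l j with hlt | rfl | hgt
  · exact iff_of_false (H.first_return z _ (by omega) (by omega)) hlt.ne
  · rw [Nat.sub_add_cancel hl.le, H.semiconj]
    exact iff_of_true (mem_range_self _) rfl
  · have : k - j + l = (l - j) + k := by omega
    rw [this, iterate_add_apply, H.semiconj]
    exact iff_of_false (H.first_return _ _ (by omega) (by omega)) hgt.ne'

theorem restrict_towerLevel {j : ℕ} (hj : j < k) :
    (towerMeasure f k h).restrict (towerLevel f k h j)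
      = (k : ℝ≥0∞)⁻¹ • (volume : Measure UnitAddCircle).map (f^[j] ∘ h) := by
  ext A hA
  rw [Measure.restrict_apply hA, H.apply (hA.inter (H.measurableSet_towerLevel j)),
    Measure.smul_apply, Measure.map_apply (H.measurable_level j) hA, smul_eq_mul,
    Finset.sum_eq_single_of_mem j (Finset.mem_range.2 hj)]
  · congr 2
    ext z
    simp [H.mem_towerLevel_iff hj hj]
  · intro l hl hlj
    have : (f^[l] ∘ h) ⁻¹' (A ∩ towerLevel f k h j) = ∅ := by
      ext z
      simp [H.mem_towerLevel_iff (Finset.mem_range.1 hl) hj, hlj]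
    rw [this, measure_empty]

/-- The map `f^[j] ∘ h` makes `f^[k]` on level `j` a factor of the doubling map, and tail sets of a
factor pull back to tail sets. -/
theorem isExact (j : ℕ) :
    IsExact f^[k] ((k : ℝ≥0∞)⁻¹ • (volume : Measure UnitAddCircle).map (f^[j] ∘ h)) := by
  have hcomm : ∀ m z, (f^[k])^[m] (f^[j] (h z))
      = f^[j] (h ((fun z : UnitAddCircle => 2 • z)^[m] z)) := by
    intro m z
    rw [← H.semiconj_iterate, ← iterate_mul, ← iterate_add_apply, ← iterate_add_apply, add_comm]
  have hk0 : (k : ℝ≥0∞)⁻¹ ≠ 0 := ENNReal.inv_ne_zero.2 (ENNReal.natCast_ne_top k)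
  refine ⟨⟨H.measurable_map.iterate k, ?_⟩, fun A hA => ?_⟩
  · rw [Measure.map_smul, Measure.map_map (H.measurable_map.iterate k) (H.measurable_level j)]
    have : f^[k] ∘ f^[j] ∘ h = (f^[j] ∘ h) ∘ fun z : UnitAddCircle => 2 • z := by
      funext z
      exact hcomm 1 z
    have hd := (AddCircle.ergodic_nsmul (T := (1 : ℝ)) one_lt_two).toMeasurePreserving
    rw [this, ← Measure.map_map (H.measurable_level j) hd.measurable, hd.map_eq]
  · have hAm : MeasurableSet A := by
      obtain ⟨B, hB, rfl⟩ := hA 0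
      exact hB
    have key := doubling_tail_trivial (A := (f^[j] ∘ h) ⁻¹' A) (fun m => by
      obtain ⟨B, hB, hAB⟩ := hA m
      refine ⟨(f^[j] ∘ h) ⁻¹' B, H.measurable_level j hB, ?_⟩
      ext z
      rw [hAB, mem_preimage, mem_preimage, mem_preimage, mem_preimage, comp_apply, hcomm,
        comp_apply])
    rw [Measure.smul_apply, Measure.smul_apply, Measure.map_apply (H.measurable_level j) hAm,
      Measure.map_apply (H.measurable_level j) hAm.compl, preimage_compl]
    rcases key with h0 | h0
    · left; rw [h0, smul_zero]
    · right; rw [h0, smul_zero]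

theorem ae_towerLevel : ∀ᵐ x ∂(towerMeasure f k h),
    ∃ j : Fin k, ∀ i : Fin k, x ∈ towerLevel f k h i ↔ i = j := by
  refine H.ae_of_forall ?_ ?_
  · have : {x | ∃ j : Fin k, ∀ i : Fin k, x ∈ towerLevel f k h i ↔ i = j}
        = ⋃ j : Fin k, ⋂ i : Fin k, {x | x ∈ towerLevel f k h i ↔ i = j} := by
      ext; simp
    rw [this]
    refine MeasurableSet.iUnion fun j => MeasurableSet.iInter fun i => ?_
    exact (H.measurableSet_towerLevel i).iff (MeasurableSet.const _)
  · intro l hl z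
    refine ⟨⟨l, hl⟩, fun i => ?_⟩
    rw [H.mem_towerLevel_iff hl i.2, Fin.ext_iff, eq_comm]

theorem preimage_towerLevel (j : Fin k) :
    f ⁻¹' towerLevel f k h (finRotate k j) =ᵐ[towerMeasure f k h] towerLevel f k h j := by
  have hmeas : MeasurableSet {x | x ∈ f ⁻¹' towerLevel f k h (finRotate k j) ↔
      x ∈ towerLevel f k h j} :=
    (H.measurable_map (H.measurableSet_towerLevel _)).iff (H.measurableSet_towerLevel _)
  have hall := H.ae_of_forall hmeas (fun l hl z => by
    have hj := j.2
    rw [mem_preimage, ← iterate_succ_apply' f, H.mem_towerLevel_iff hl j.2]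
    have hrot := val_finRotate j
    rcases Nat.lt_or_ge (l + 1) k with hlk | hlk
    · rw [H.mem_towerLevel_iff hlk (finRotate k j).2, hrot]
      by_cases hjk : (j : ℕ) + 1 = k
      · rw [if_pos hjk]; omega
      · rw [if_neg hjk]; omega
    · obtain rfl : k = l + 1 := by omega
      rw [H.semiconj]
      have := H.mem_towerLevel_iff (l := 0) (by omega) (finRotate (l + 1) j).2 (2 • z)
      rw [iterate_zero, id] at this
      rw [this, hrot]
      by_cases hjk : (j : ℕ) + 1 = l + 1
      · rw [if_pos hjk]; omega
      · rw [if_neg hjk]; omega)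
  filter_upwards [hall] with x hx
  exact propext hx

theorem hasMixingPeriod : HasMixingPeriod f (towerMeasure f k h) k := by
  classical
  have := H.isProbabilityMeasure
  have : NeZero k := ⟨H.pos.ne'⟩
  set μ := towerMeasure f k h with hμ
  have hsupp : MeasurableSet μ.support := Measure.isClosed_support.measurableSet
  let E : Fin k → Set ℝ := fun j => towerLevel f k h j
  have hE : ∀ j, MeasurableSet (E j) := fun j => H.measurableSet_towerLevel _
  -- The levels are disjoint and fill the support only up to null sets, whereas `HasMixingPeriod`
  -- asks for both exactly. So overlaps are removed here, and the component of index 0 absorbs the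
  -- null remainder of the support.
  let D : Fin k → Set ℝ := fun j => (E j ∩ μ.support) \ ⋃ i ∈ {i | i ≠ j}, E i
  let C : Fin k → Set ℝ := fun j =>
    if j = 0 then μ.support \ ⋃ i ∈ {i : Fin k | i ≠ 0}, D i else D j
  have hD : ∀ j, MeasurableSet (D j) := fun j =>
    ((hE j).inter hsupp).diff (MeasurableSet.biUnion (to_countable _) fun i _ => hE i)
  have hC : ∀ j, MeasurableSet (C j) := by
    intro j
    by_cases hj : j = 0
    · simp only [C, hj, if_true]
      exact hsupp.diff (MeasurableSet.biUnion (to_countable _) fun i _ => hD i)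
    · simp only [C, hj, if_false]
      exact hD j
  have hDD : ∀ i j x, x ∈ D i → x ∈ D j → i = j := by
    intro i j x hi hj
    by_contra hne
    exact hj.2 (mem_biUnion (show i ∈ {i | i ≠ j} from hne) hi.1.1)
  have hCE : ∀ j, C j =ᵐ[μ] E j := by
    intro j
    filter_upwards [H.ae_towerLevel, (Measure.support_mem_ae : μ.support ∈ ae μ)] with x hx hxs
    obtain ⟨j₀, hj₀⟩ := hx
    have hxD : ∀ i, x ∈ D i ↔ i = j₀ := by
      intro i
      constructor
      · intro hi
        exact (hj₀ i).1 hi.1.1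
      · rintro rfl
        refine ⟨⟨(hj₀ i).2 rfl, hxs⟩, fun hx' => ?_⟩
        obtain ⟨i', hi', hx'⟩ := mem_iUnion₂.1 hx'
        exact hi' ((hj₀ i').1 hx')
    refine propext ?_
    change x ∈ C j ↔ x ∈ towerLevel f k h j
    rw [hj₀ j]
    by_cases hj : j = 0
    · subst hj
      simp only [C, if_true, Set.mem_sdiff, mem_iUnion, hxD, hxs, true_and, mem_ofPred_eq, exists_prop,
        exists_eq_right]
      exact ⟨fun h => (not_not.1 h).symm, fun h => not_not.2 h.symm⟩
    · simp only [C, hj, if_false]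
      exact hxD j
  refine ⟨H.pos, C, hC, ?_, ?_, ?_, ?_⟩
  · intro i j hij
    rw [Set.disjoint_left]
    intro x hi hj
    by_cases hi0 : i = 0
    · have hj0 : j ≠ 0 := fun h => hij (hi0.trans h.symm)
      simp only [C, hi0, hj0, if_true, if_false] at hi hj
      exact hi.2 (mem_biUnion (show j ∈ {i : Fin k | i ≠ 0} from hj0) hj)
    · by_cases hj0 : j = 0
      · simp only [C, hi0, hj0, if_true, if_false] at hi hj
        exact hj.2 (mem_biUnion (show i ∈ {i : Fin k | i ≠ 0} from hi0) hi)
      · simp only [C, hi0, hj0, if_false] at hi hj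
        exact hij (hDD i j x hi hj)
  · refine Subset.antisymm (iUnion_subset fun j => ?_) fun x hx => ?_
    · by_cases hj : j = 0
      · simp only [C, hj, if_true]
        exact sdiff_subset
      · simp only [C, hj, if_false]
        exact fun x hx => hx.1.2
    · by_cases hx0 : x ∈ ⋃ i ∈ {i : Fin k | i ≠ 0}, D i
      · obtain ⟨i, hi, hxi⟩ := mem_iUnion₂.1 hx0
        refine mem_iUnion.2 ⟨i, ?_⟩
        have hi' : i ≠ 0 := hi
        simp only [C, hi', if_false]
        exact hxi
      · refine mem_iUnion.2 ⟨0, ?_⟩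
        simp only [C, if_true]
        exact ⟨hx, hx0⟩
  · intro j
    exact (H.measurePreserving.quasiMeasurePreserving.preimage_ae_eq (hCE _)).trans
      ((H.preimage_towerLevel j).trans (hCE j).symm)
  · intro j
    rw [Measure.restrict_congr_set (hCE j), H.restrict_towerLevel j.2]
    exact H.isExact j

/-- The base agrees `ν`-a.e. with its preimage under `f^[k]`, so `ν` restricted to it is
`f^[k]`-invariant. In the circle coordinate this restriction is absolutely continuous and
doubling-invariant, hence a multiple of Lebesgue measure, nonzero since the base is charged. Thus
the tower measure is absolutely continuous with respect to the ergodic `ν`, which forces equality.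
-/
theorem eq_towerMeasure {ν : Measure ℝ} [IsProbabilityMeasure ν] (hν : Ergodic f ν)
    (hpos : ν (range h) ≠ 0) {g : ℝ → UnitAddCircle} (hg : Measurable g) (hgh : ∀ z, g (h z) = z)
    (hac : (ν.restrict (range h)).map g ≪ volume) : ν = towerMeasure f k h := by
  have hfk : MeasurePreserving f^[k] ν ν := hν.toMeasurePreserving.iterate k
  have hK := H.measurableSet_range
  have hsub : range h ⊆ f^[k] ⁻¹' range h := by
    rintro _ ⟨z, rfl⟩
    exact ⟨2 • z, (H.semiconj z).symm⟩
  have hKae : range h =ᵐ[ν] f^[k] ⁻¹' range h :=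
    ae_eq_of_subset_of_measure_ge hsub (hfk.measure_preimage hK.nullMeasurableSet).le
      hK.nullMeasurableSet (measure_ne_top _ _)
  have hres : MeasurePreserving f^[k] (ν.restrict (range h)) (ν.restrict (range h)) := by
    have := hfk.restrict_preimage hK
    rwa [← Measure.restrict_congr_set hKae] at this
  have hd := AddCircle.ergodic_nsmul (T := (1 : ℝ)) one_lt_two
  have hinv : MeasurePreserving (fun z : UnitAddCircle => 2 • z)
      ((ν.restrict (range h)).map g) ((ν.restrict (range h)).map g) := by
    refine ⟨hd.measurable, ?_⟩
    rw [Measure.map_map hd.measurable hg]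
    have : (fun z : UnitAddCircle => 2 • z) ∘ g =ᵐ[ν.restrict (range h)] g ∘ f^[k] := by
      filter_upwards [ae_restrict_mem hK] with x hx
      obtain ⟨z, rfl⟩ := hx
      simp [H.semiconj, hgh]
    rw [Measure.map_congr this, ← Measure.map_map hg hres.measurable, hres.map_eq]
  obtain ⟨c, hc⟩ := hd.eq_smul_of_absolutelyContinuous hinv hac
  have hback : ν.restrict (range h) = c • (volume : Measure UnitAddCircle).map h := by
    rw [← Measure.map_smul, ← hc, Measure.map_map H.measurable hg]
    have : h ∘ g =ᵐ[ν.restrict (range h)] id := by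
      filter_upwards [ae_restrict_mem hK] with x hx
      obtain ⟨z, rfl⟩ := hx
      simp [hgh]
    rw [Measure.map_congr this, Measure.map_id]
  have hc0 : c ≠ 0 := by
    rintro rfl
    rw [zero_smul, Measure.restrict_eq_zero] at hback
    exact hpos hback
  have hbase : (volume : Measure UnitAddCircle).map h ≪ ν := by
    refine Measure.AbsolutelyContinuous.trans ?_ (Measure.absolutelyContinuous_of_le
      (Measure.restrict_le_self (s := range h)))
    rw [hback]
    exact Measure.absolutelyContinuous_smul hc0
  have := H.isProbabilityMeasure
  refine (hν.eq_of_absolutelyContinuous H.measurePreserving ?_).symm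
  refine Measure.AbsolutelyContinuous.mk fun B hB hB0 => ?_
  rw [H.apply hB, Finset.sum_eq_zero, mul_zero]
  intro l _
  have h1 : ν (f^[l] ⁻¹' B) = 0 := by
    rw [(hν.toMeasurePreserving.iterate l).measure_preimage hB.nullMeasurableSet, hB0]
  have h2 := hbase h1
  rwa [Measure.map_apply H.measurable (H.measurable_map.iterate l hB), ← preimage_comp] at h2

theorem towerMeasure_absolutelyContinuous {η : Measure ℝ}
    (hf : η.map f ≪ η) (hh : (volume : Measure UnitAddCircle).map h ≪ η) :
    towerMeasure f k h ≪ η := by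
  have hf' : ∀ l, η.map f^[l] ≪ η := by
    intro l
    induction l with
    | zero => rw [iterate_zero, Measure.map_id]
    | succ l ih =>
      rw [iterate_succ', ← Measure.map_map H.measurable_map (H.measurable_map.iterate l)]
      exact (ih.map H.measurable_map).trans hf
  refine Measure.AbsolutelyContinuous.mk fun B hB hB0 => ?_
  rw [H.apply hB, Finset.sum_eq_zero, mul_zero]
  intro l _
  have h1 : η (f^[l] ⁻¹' B) = 0 := by
    rw [← Measure.map_apply (H.measurable_map.iterate l) hB]
    exact hf' l hB0
  have h2 := hh h1
  rwa [Measure.map_apply H.measurable (H.measurable_map.iterate l hB), ← preimage_comp] at h2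

end IsDoublingTower

/-! ### Affine parametrisations of intervals by the circle -/

theorem volume_preimage_affine_eq_zero {u : ℝ} (hu : u ≠ 0) (v : ℝ) {A : Set ℝ}
    (hA : volume A = 0) : volume ((fun s => u * s + v) ⁻¹' A) = 0 := by
  have : (fun s => u * s + v) ⁻¹' A = (u * ·) ⁻¹' ((· + v) ⁻¹' A) := rfl
  rw [this, Real.volume_preimage_mul_left hu, measure_preimage_add_right, hA, mul_zero]

/-- The parametrisation of the interval `(p, p + q]` by the circle. -/
noncomputable def circleParam (p q : ℝ) (z : UnitAddCircle) : ℝ := q * (AddCircle.equivIoc (1 : ℝ) 0 z : ℝ) + p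

/-- The inverse of `circleParam`. -/
noncomputable def circleCoord (p q : ℝ) (s : ℝ) : UnitAddCircle := ((q⁻¹ * s + -(q⁻¹ * p) : ℝ) : UnitAddCircle)

theorem circleParam_coe (p q : ℝ) {u : ℝ} (hu : u ∈ Ioc (0 : ℝ) 1) :
    circleParam p q (u : UnitAddCircle) = q * u + p := by
  rw [circleParam, AddCircle.equivIoc_coe_of_mem]
  simpa using hu

theorem exists_coe_eq (z : UnitAddCircle) : ∃ u ∈ Ioc (0 : ℝ) 1, (u : UnitAddCircle) = z :=
  ⟨AddCircle.equivIoc (1 : ℝ) 0 z, by simpa using (AddCircle.equivIoc (1 : ℝ) 0 z).2,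
    AddCircle.coe_equivIoc⟩

theorem measurable_circleParam (p q : ℝ) : Measurable (circleParam p q) := by
  unfold circleParam
  exact ((measurable_subtype_coe.comp
    (AddCircle.measurableEquivIoc (1 : ℝ) 0).measurable).const_mul q).add_const p

theorem measurable_circleCoord (p q : ℝ) : Measurable (circleCoord p q) :=
  AddCircle.measurable_mk'.comp (by fun_prop)

theorem circleCoord_circleParam (p : ℝ) {q : ℝ} (hq : q ≠ 0) (z : UnitAddCircle) :
    circleCoord p q (circleParam p q z) = z := by
  obtain ⟨u, hu, rfl⟩ := exists_coe_eq z
  rw [circleParam_coe p q hu, circleCoord]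
  congr 1
  field_simp
  ring

theorem range_circleParam (p : ℝ) {q : ℝ} (hq : 0 < q) : range (circleParam p q) = Ioc p (p + q) := by
  ext s
  constructor
  · rintro ⟨z, rfl⟩
    obtain ⟨u, hu, rfl⟩ := exists_coe_eq z
    rw [circleParam_coe p q hu]
    constructor <;> nlinarith [hu.1, hu.2]
  · intro hs
    have hu : (s - p) / q ∈ Ioc (0 : ℝ) 1 :=
      ⟨div_pos (by linarith [hs.1]) hq, (div_le_one hq).2 (by linarith [hs.2])⟩
    refine ⟨(((s - p) / q : ℝ) : UnitAddCircle), ?_⟩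
    rw [circleParam_coe p q hu]
    field_simp
    ring

theorem map_circleParam_absolutelyContinuous (p : ℝ) {q : ℝ} (hq : 0 < q) :
    (volume : Measure UnitAddCircle).map (circleParam p q)
      ≪ volume.restrict (Ioc p (p + q)) := by
  refine Measure.AbsolutelyContinuous.mk fun B hB hB0 => ?_
  rw [Measure.map_apply (measurable_circleParam p q) hB,
    ← (UnitAddCircle.measurePreserving_mk 0).measure_preimage
      (measurable_circleParam p q hB).nullMeasurableSet, Measure.restrict_apply']
  · rw [Measure.restrict_apply hB] at hB0
    refine measure_mono_null ?_ (volume_preimage_affine_eq_zero hq.ne' p hB0)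
    rintro u ⟨hu, hu1⟩
    rw [zero_add] at hu1
    have h1 : circleParam p q (u : UnitAddCircle) ∈ B := hu
    have h2 : circleParam p q (u : UnitAddCircle) ∈ Ioc p (p + q) := by
      rw [← range_circleParam p hq]; exact mem_range_self _
    rw [circleParam_coe p q hu1] at h1 h2
    exact ⟨h1, h2⟩
  · exact measurableSet_Ioc

theorem map_circleCoord_absolutelyContinuous (p : ℝ) {q : ℝ} (hq : 0 < q) {ν : Measure ℝ}
    (hν : ν ≪ volume) :
    (ν.restrict (range (circleParam p q))).map (circleCoord p q) ≪ volume := by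
  refine Measure.AbsolutelyContinuous.mk fun B hB hB0 => ?_
  rw [Measure.map_apply (measurable_circleCoord p q) hB,
    Measure.restrict_apply (measurable_circleCoord p q hB)]
  refine hν ?_
  rw [← (UnitAddCircle.measurePreserving_mk 0).measure_preimage hB.nullMeasurableSet,
    Measure.restrict_apply' measurableSet_Ioc] at hB0
  refine measure_mono_null ?_
    (volume_preimage_affine_eq_zero (inv_ne_zero hq.ne') (-(q⁻¹ * p)) hB0)
  rintro s ⟨hs, hs'⟩
  refine ⟨hs, ?_⟩
  rw [range_circleParam p hq] at hs'
  have : q⁻¹ * s + -(q⁻¹ * p) = (s - p) / q := by field_simp; ring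
  change q⁻¹ * s + -(q⁻¹ * p) ∈ _
  rw [zero_add, this]
  exact ⟨div_pos (by linarith [hs'.1]) hq, (div_le_one hq).2 (by linarith [hs'.2])⟩

/-! ### Symmetric Lorenz maps and their renormalisation -/

/-- The symmetric Lorenz map with slope `lam` and jump from `c` to `-c` at the origin. -/
noncomputable def lorenz (lam c x : ℝ) : ℝ := if x ≤ 0 then lam * x + c else lam * x - c

theorem lorenz_of_nonpos {lam c x : ℝ} (hx : x ≤ 0) : lorenz lam c x = lam * x + c := if_pos hx

theorem lorenz_of_pos {lam c x : ℝ} (hx : 0 < x) : lorenz lam c x = lam * x - c :=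
  if_neg hx.not_ge

section OneStep

variable {lam c x : ℝ}

theorem lorenz_mem (hlam : 1 < lam) (hlam2 : lam ≤ 2) (hx : x ∈ Ioc (-c) c) :
    lorenz lam c x ∈ Ioc (-c) c := by
  have hc : 0 < c := by linarith [hx.1, hx.2]
  rcases le_or_gt x 0 with h | h
  · rw [lorenz_of_nonpos h]
    constructor <;> nlinarith [hx.1]
  · rw [lorenz_of_pos h]
    constructor <;> nlinarith [hx.2]

/-- On the smaller interval each branch is followed by the other one, so the jumps `c` and `-c`
combine to `± c * (lam - 1)`. -/
theorem lorenz_lorenz (hlam : 1 < lam) (hlam2 : lam ^ 2 ≤ 2) (hc : 0 < c)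
    (hx : x ∈ Ioc (-(c * (lam - 1))) (c * (lam - 1))) :
    lorenz lam c (lorenz lam c x) = lorenz (lam ^ 2) (c * (lam - 1)) x := by
  -- Here `lam ^ 2 ≤ 2 < lam + 1`; this is what sends each half of the interval to the opposite
  -- branch.
  have h1 : c * (lam ^ 2 - lam - 1) < 0 := mul_neg_of_pos_of_neg hc (by nlinarith)
  rcases le_or_gt x 0 with h | h
  · rw [lorenz_of_nonpos h, lorenz_of_nonpos h, lorenz_of_pos (by nlinarith [hx.1])]
    ring
  · rw [lorenz_of_pos h, lorenz_of_pos h, lorenz_of_nonpos (by nlinarith [hx.2])]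
    ring

theorem lorenz_notMem (hlam : 1 < lam) (hlam2 : lam ^ 2 ≤ 2) (hc : 0 < c)
    (hx : x ∈ Ioc (-(c * (lam - 1))) (c * (lam - 1))) :
    lorenz lam c x ∉ Ioc (-(c * (lam - 1))) (c * (lam - 1)) := by
  have h1 : c * (lam ^ 2 - 2) ≤ 0 := mul_nonpos_of_nonneg_of_nonpos hc.le (by linarith)
  rcases le_or_gt x 0 with h | h
  · rw [lorenz_of_nonpos h]
    intro hy
    nlinarith [hx.1, hy.2]
  · rw [lorenz_of_pos h]
    intro hy
    nlinarith [hx.2, hy.1]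

/-- The points `± c / (lam + 1)` form an orbit of period two. An orbit avoiding the smaller interval
changes sign at every step, so the distance of `|x|` to `c / (lam + 1)` grows by the factor `lam`
each time, which is impossible for a bounded orbit unless this distance is zero. -/
theorem exists_lorenz_iterate_mem_renormalized (hlam : 1 < lam) (hlam2 : lam ≤ 2)
    (hx : x ∈ Ioc (-c) c) (hx1 : x ≠ c / (lam + 1)) (hx2 : x ≠ -(c / (lam + 1))) :
    ∃ t, (lorenz lam c)^[t] x ∈ Ioc (-(c * (lam - 1))) (c * (lam - 1)) := by
  have hc : 0 < c := by linarith [hx.1, hx.2]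
  by_contra! hout
  set y := c / (lam + 1) with hy
  have hcy : c = (lam + 1) * y := by rw [hy]; field_simp
  have hc' : 0 < c * (lam - 1) := mul_pos hc (by linarith)
  have hmem : ∀ t, (lorenz lam c)^[t] x ∈ Ioc (-c) c := by
    intro t
    induction t with
    | zero => exact hx
    | succ t ih => rw [iterate_succ_apply']; exact lorenz_mem hlam hlam2 ih
  have hstep : ∀ t, |(lorenz lam c)^[t + 1] x| - y = -lam * (|(lorenz lam c)^[t] x| - y) := by
    intro t
    have h0 := hmem t
    have h1 := hmem (t + 1)
    have h2 := hout t
    have h3 := hout (t + 1)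
    rw [iterate_succ_apply'] at h1 h3 ⊢
    generalize (lorenz lam c)^[t] x = z at h0 h1 h2 h3
    rcases le_or_gt z 0 with hz | hz
    · rw [lorenz_of_nonpos hz] at h1 h3 ⊢
      -- If the image stayed on the same side of 0, it would lie in the smaller interval.
      have h4 : 0 < lam * z + c := by
        by_contra! h5
        exact h3 ⟨by nlinarith [h0.1], by linarith⟩
      rw [abs_of_pos h4, abs_of_nonpos hz]
      linarith
    · rw [lorenz_of_pos hz] at h1 h3 ⊢
      have h4 : lam * z - c < 0 := by
        by_contra! h5
        exact h3 ⟨by linarith, by nlinarith [h0.2]⟩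
      rw [abs_of_neg h4, abs_of_pos hz]
      linarith
  have hpow : ∀ t, |(lorenz lam c)^[t] x| - y = (-lam) ^ t * (|x| - y) := by
    intro t
    induction t with
    | zero => simp
    | succ t ih => rw [hstep, ih, pow_succ]; ring
  have hne : 0 < |(|x| - y)| := by
    rw [abs_pos, sub_ne_zero]
    intro h
    rcases abs_choice x with h' | h'
    · exact hx1 (h'.symm.trans h)
    · exact hx2 (by linarith)
  obtain ⟨t, ht⟩ := pow_unbounded_of_one_lt (c / |(|x| - y)|) hlam
  have h1 : |(|(lorenz lam c)^[t] x| - y)| = lam ^ t * |(|x| - y)| := by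
    rw [hpow, abs_mul, abs_pow, abs_neg, abs_of_pos (by linarith : 0 < lam)]
  have h2 : |(lorenz lam c)^[t] x| ≤ c := abs_le.2 ⟨(hmem t).1.le, (hmem t).2⟩
  have hy0 : 0 < y := by positivity
  have h3 : |(|(lorenz lam c)^[t] x| - y)| ≤ c :=
    abs_le.2 ⟨by nlinarith [abs_nonneg ((lorenz lam c)^[t] x)], by linarith⟩
  rw [div_lt_iff₀ hne] at ht
  linarith

theorem exists_lorenz_iterate_mem {w : ℝ} (hlam : 1 < lam) (hc : 0 < c) (hcw : c < w)
    (hw : (lam - 1) * w < c) (hx : x ∈ Ioo (-w) w) :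
    ∃ t, (lorenz lam c)^[t] x ∈ Ioc (-c) c := by
  -- Outside `(-c, c]` every step lowers `|x|` by at least `δ`.
  set δ := c - (lam - 1) * w with hδ
  have hδ0 : 0 < δ := by linarith
  obtain ⟨N, hN⟩ := exists_nat_gt (w / δ)
  rw [div_lt_iff₀ hδ0] at hN
  have hxN : |x| ≤ c + N * δ := by
    have := abs_lt.2 hx
    linarith
  clear hN
  induction N generalizing x with
  | zero =>
    rw [Nat.cast_zero, zero_mul, add_zero, abs_le] at hxN
    rcases eq_or_lt_of_le hxN.1 with h | h
    -- The excluded endpoint `-c` of the half-open interval needs one more step.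
    · refine ⟨1, ?_⟩
      rw [iterate_one, ← h, lorenz_of_nonpos (by linarith)]
      constructor <;> nlinarith
    · exact ⟨0, h, hxN.2⟩
  | succ N ih =>
    rw [Nat.cast_succ, add_mul, one_mul, abs_le] at hxN
    have hNδ : 0 ≤ N * δ := by positivity
    have hlx : (lam - 1) * x < (lam - 1) * w := by nlinarith [hx.2]
    have hlx' : -((lam - 1) * w) < (lam - 1) * x := by nlinarith [hx.1]
    have key : lorenz lam c x ∈ Ioo (-w) w → |lorenz lam c x| ≤ c + N * δ →
        ∃ t, (lorenz lam c)^[t] x ∈ Ioc (-c) c := by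
      intro h1 h2
      obtain ⟨t, ht⟩ := ih h1 h2
      exact ⟨t + 1, ht⟩
    by_cases hK : x ∈ Ioc (-c) c
    · exact ⟨0, hK⟩
    · rcases le_or_gt x 0 with h | h
      · have hxc : x ≤ -c := by
          by_contra! h'
          exact hK ⟨h', by linarith⟩
        rw [lorenz_of_nonpos h] at key
        refine key ⟨by linarith [hx.1], by nlinarith⟩ (abs_le.2 ⟨by linarith, by nlinarith⟩)
      · have hxc : c < x := by
          by_contra! h'
          exact hK ⟨by linarith, h'⟩
        rw [lorenz_of_pos h] at key
        refine key ⟨by nlinarith, by linarith [hx.2]⟩ (abs_le.2 ⟨by nlinarith, by linarith⟩)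

/-- The value `c` of the Lorenz map at 0 matches the representatives in `(0, 1]`: the midpoint `1/2`
doubles to `1`. This is why all intervals are half-open on the left. -/
theorem lorenz_two_circleParam (hc : 0 < c) (z : UnitAddCircle) :
    lorenz 2 c (circleParam (-c) (2 * c) z) = circleParam (-c) (2 * c) (2 • z) := by
  obtain ⟨u, hu, rfl⟩ := exists_coe_eq z
  rw [circleParam_coe _ _ hu]
  rcases le_or_gt u (1 / 2) with h | h
  · have h2 : (2 • (u : UnitAddCircle)) = ((2 * u : ℝ) : UnitAddCircle) := by
      rw [two_nsmul, two_mul, AddCircle.coe_add]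
    rw [h2, circleParam_coe _ _ ⟨by linarith [hu.1], by linarith⟩,
      lorenz_of_nonpos (by nlinarith)]
    ring
  · have h2 : (2 • (u : UnitAddCircle)) = ((2 * u - 1 : ℝ) : UnitAddCircle) := by
      rw [two_nsmul, two_mul, AddCircle.coe_sub, AddCircle.coe_add, AddCircle.coe_period, sub_zero]
    rw [h2, circleParam_coe _ _ ⟨by linarith [hu.1], by linarith [hu.2]⟩,
      lorenz_of_pos (by nlinarith)]
    ring

end OneStep

/-- The half-widths of the successive renormalisation intervals. -/
noncomputable def renormWidth (lam c : ℝ) : ℕ → ℝ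
  | 0 => c
  | k + 1 => renormWidth lam c k * (lam ^ 2 ^ k - 1)

section Renormalization

variable {lam c : ℝ} {m : ℕ} (hlam : 1 < lam) (hm : lam ^ 2 ^ m = 2) (hc : 0 < c)
include hlam

theorem one_lt_pow_two_pow (k : ℕ) : 1 < lam ^ 2 ^ k :=
  one_lt_pow₀ hlam (by positivity)

include hm in
theorem pow_two_pow_le {k : ℕ} (hk : k ≤ m) : lam ^ 2 ^ k ≤ 2 := by
  rw [← hm]
  exact pow_le_pow_right₀ hlam.le (Nat.pow_le_pow_right (by norm_num) hk)

include hm in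
theorem sq_pow_two_pow_le {k : ℕ} (hk : k < m) : (lam ^ 2 ^ k) ^ 2 ≤ 2 := by
  rw [← pow_mul, ← pow_succ]
  exact pow_two_pow_le hlam hm hk

include hc in
theorem renormWidth_pos (k : ℕ) : 0 < renormWidth lam c k := by
  induction k with
  | zero => exact hc
  | succ k ih => exact mul_pos ih (by linarith [one_lt_pow_two_pow hlam k])

include hm hc

theorem renormInterval_subset {k : ℕ} (hk : k < m) :
    Ioc (-renormWidth lam c (k + 1)) (renormWidth lam c (k + 1))
      ⊆ Ioc (-renormWidth lam c k) (renormWidth lam c k) := by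
  have h1 := renormWidth_pos hlam hc k
  have h2 := pow_two_pow_le hlam hm hk.le
  have h : renormWidth lam c (k + 1) ≤ renormWidth lam c k := by
    rw [renormWidth]
    nlinarith
  exact Ioc_subset_Ioc (neg_le_neg h) h

theorem lorenz_iterate_two_pow {k : ℕ} (hk : k ≤ m) {x : ℝ}
    (hx : x ∈ Ioc (-renormWidth lam c k) (renormWidth lam c k)) :
    (lorenz lam c)^[2 ^ k] x = lorenz (lam ^ 2 ^ k) (renormWidth lam c k) x := by
  induction k generalizing x with
  | zero => simp [renormWidth]
  | succ k ih =>
    have hk' : k < m := hk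
    have hx' := renormInterval_subset hlam hm hc hk' hx
    have h1 := one_lt_pow_two_pow hlam k
    rw [pow_succ, mul_two, iterate_add_apply, ih hk'.le hx',
      ih hk'.le (lorenz_mem h1 (pow_two_pow_le hlam hm hk'.le) hx'), ← mul_two, pow_mul,
      renormWidth]
    exact lorenz_lorenz h1 (sq_pow_two_pow_le hlam hm hk') (renormWidth_pos hlam hc k) hx

theorem lorenz_iterate_two_pow_mem {k : ℕ} (hk : k ≤ m) {x : ℝ}
    (hx : x ∈ Ioc (-renormWidth lam c k) (renormWidth lam c k)) :
    (lorenz lam c)^[2 ^ k] x ∈ Ioc (-renormWidth lam c k) (renormWidth lam c k) := by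
  rw [lorenz_iterate_two_pow hlam hm hc hk hx]
  exact lorenz_mem (one_lt_pow_two_pow hlam k) (pow_two_pow_le hlam hm hk) hx

/-- By induction, only time `2 ^ k` could be a return to the larger interval of level `k`, and
`lorenz_notMem` for the renormalised map excludes it. -/
theorem lorenz_iterate_notMem {k : ℕ} (hk : k ≤ m) {x : ℝ}
    (hx : x ∈ Ioc (-renormWidth lam c k) (renormWidth lam c k)) {r : ℕ} (hr : 0 < r)
    (hrk : r < 2 ^ k) :
    (lorenz lam c)^[r] x ∉ Ioc (-renormWidth lam c k) (renormWidth lam c k) := by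
  induction k generalizing x r with
  | zero => simp at hrk; omega
  | succ k ih =>
    have hk' : k < m := hk
    have hsub := renormInterval_subset hlam hm hc hk'
    have hx' := hsub hx
    intro hmem
    rcases lt_trichotomy r (2 ^ k) with h | h | h
    · exact ih hk'.le hx' hr h (hsub hmem)
    · rw [h, lorenz_iterate_two_pow hlam hm hc hk'.le hx'] at hmem
      exact lorenz_notMem (one_lt_pow_two_pow hlam k) (sq_pow_two_pow_le hlam hm hk')
        (renormWidth_pos hlam hc k) hx hmem
    · have hr' : r = (r - 2 ^ k) + 2 ^ k := by omega
      rw [hr', iterate_add_apply] at hmem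
      refine ih hk'.le (lorenz_iterate_two_pow_mem hlam hm hc hk'.le hx') ?_ ?_ (hsub hmem)
      · omega
      · rw [pow_succ] at hrk; omega

theorem exists_lorenz_iterate_mem_succ {k : ℕ} (hk : k < m) {x : ℝ}
    (hx : x ∈ Ioc (-renormWidth lam c k) (renormWidth lam c k))
    (hx1 : x ≠ renormWidth lam c k / (lam ^ 2 ^ k + 1))
    (hx2 : x ≠ -(renormWidth lam c k / (lam ^ 2 ^ k + 1))) :
    ∃ t, (lorenz lam c)^[t] x
      ∈ Ioc (-renormWidth lam c (k + 1)) (renormWidth lam c (k + 1)) := by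
  have h1 := one_lt_pow_two_pow hlam k
  have h2 := pow_two_pow_le hlam hm hk.le
  obtain ⟨t, ht⟩ := exists_lorenz_iterate_mem_renormalized h1 h2 hx hx1 hx2
  refine ⟨2 ^ k * t, ?_⟩
  have : ∀ s, (lorenz lam c)^[2 ^ k * s] x = (lorenz (lam ^ 2 ^ k) (renormWidth lam c k))^[s] x ∧
      (lorenz lam c)^[2 ^ k * s] x ∈ Ioc (-renormWidth lam c k) (renormWidth lam c k) := by
    intro s
    induction s with
    | zero => simpa using hx
    | succ s ih =>
      rw [Nat.mul_succ, Nat.add_comm, iterate_add_apply, iterate_succ_apply', ← ih.1]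
      exact ⟨lorenz_iterate_two_pow hlam hm hc hk.le ih.2,
        lorenz_iterate_two_pow_mem hlam hm hc hk.le ih.2⟩
  rw [(this t).1]
  exact ht

end Renormalization

theorem exists_pow_two_pow_eq_two {ε : ℝ} (hε : 0 < ε) :
    ∃ (lam : ℝ) (m : ℕ), 1 < lam ∧ lam < 1 + ε ∧ lam ^ 2 ^ m = 2 := by
  -- The slope is the `2^m`-th root of 2; Bernoulli's inequality gives `(1 + ε)^(2^m) > 2` once `2^m
  -- * ε > 1`.
  obtain ⟨m, hm⟩ := pow_unbounded_of_one_lt (1 / ε) (one_lt_two (α := ℝ))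
  rw [div_lt_iff₀ hε] at hm
  have hN : ((2 ^ m : ℕ) : ℝ) ≠ 0 := by positivity
  have hpow : ((2 : ℝ) ^ (((2 ^ m : ℕ) : ℝ)⁻¹)) ^ 2 ^ m = 2 :=
    Real.rpow_inv_natCast_pow (by norm_num) (by positivity)
  refine ⟨(2 : ℝ) ^ (((2 ^ m : ℕ) : ℝ)⁻¹), m, Real.one_lt_rpow (by norm_num) (by positivity), ?_,
    hpow⟩
  refine lt_of_pow_lt_pow_left₀ (2 ^ m) (by linarith) ?_
  rw [hpow]
  have := one_add_mul_le_pow (a := ε) (by linarith) (2 ^ m)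
  push_cast at this
  linarith

/-! ### Interval maps made of Lorenz systems of period two -/

theorem measurable_of_eqOn_cover {ι : Type*} [Countable ι] {f : ℝ → ℝ} {S : ι → Set ℝ}
    {g : ι → ℝ → ℝ} (hS : ∀ i, MeasurableSet (S i)) (hg : ∀ i, Measurable (g i))
    (hfg : ∀ i, EqOn f (g i) (S i)) (hc : (⋃ i, S i)ᶜ.Countable) : Measurable f := by
  intro A hA
  have : f ⁻¹' A = (⋃ i, S i ∩ g i ⁻¹' A) ∪ (f ⁻¹' A ∩ (⋃ i, S i)ᶜ) := by
    ext x
    constructor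
    · intro hx
      by_cases hxS : x ∈ ⋃ i, S i
      · obtain ⟨i, hi⟩ := mem_iUnion.1 hxS
        exact Or.inl (mem_iUnion.2 ⟨i, hi, by rw [mem_preimage, ← hfg i hi]; exact hx⟩)
      · exact Or.inr ⟨hx, hxS⟩
    · rintro (hx | hx)
      · obtain ⟨i, hi, hx⟩ := mem_iUnion.1 hx
        rw [mem_preimage, hfg i hi]
        exact hx
      · exact hx.1
  rw [this]
  exact (MeasurableSet.iUnion fun i => (hS i).inter (hg i hA)).union
    (hc.mono inter_subset_right).measurableSet

/-- Were `S'` null, all its preimages would be null by invariance, and together with `E` they cover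
`S`. This passes positive mass down to ever smaller intervals. -/
theorem measure_ne_zero_of_forall_exists_iterate_mem {ν : Measure ℝ} {f : ℝ → ℝ}
    (hf : MeasurePreserving f ν ν) {S S' E : Set ℝ} (hS : ν S ≠ 0) (hS' : MeasurableSet S')
    (hE : ν E = 0) (hent : ∀ x ∈ S, x ∉ E → ∃ t, f^[t] x ∈ S') : ν S' ≠ 0 := by
  intro h0
  refine hS (measure_mono_null (t := E ∪ ⋃ t, f^[t] ⁻¹' S') ?_ ?_)
  · intro x hx
    by_cases hxE : x ∈ E
    · exact Or.inl hxE
    · exact Or.inr (mem_iUnion.2 (hent x hx hxE))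
  · refine measure_union_null hE (measure_iUnion_null fun t => ?_)
    rw [(hf.iterate t).measure_preimage hS'.nullMeasurableSet, h0]

theorem measurable_lorenz (lam c : ℝ) : Measurable (lorenz lam c) :=
  Measurable.ite measurableSet_Iic (by fun_prop) (by fun_prop)

theorem volume_preimage_lorenz_eq_zero {lam : ℝ} (hlam : lam ≠ 0) (c : ℝ) {A : Set ℝ}
    (hA : volume A = 0) : volume (lorenz lam c ⁻¹' A) = 0 := by
  refine measure_mono_null (t := (fun x => lam * x + c) ⁻¹' A ∪ (fun x => lam * x + -c) ⁻¹' A) ?_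
    (measure_union_null (volume_preimage_affine_eq_zero hlam _ hA)
      (volume_preimage_affine_eq_zero hlam _ hA))
  intro x hx
  rw [mem_preimage] at hx
  rcases le_or_gt x 0 with h | h
  · rw [lorenz_of_nonpos h] at hx
    exact Or.inl hx
  · rw [lorenz_of_pos h] at hx
    exact Or.inr hx

/-- Up to countably many points, the interval `[0, L]` consists of `n` pairs of intervals: the
intervals of radius `w` around the points `q i`, and the intervals of radius `s * w` around the
points `p i`. The map `f` exchanges the two intervals of a pair, and its second iterate on the
first of them is a symmetric Lorenz map. -/
structure IsLorenzSystem (f : ℝ → ℝ) (L : ℝ) {n : ℕ} (lam c w s : ℝ) (q p : Fin n → ℝ) :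
    Prop where
  scale_pos : 0 < s
  eq_zero : ∀ x ∉ Icc 0 L, f x = 0
  mem_Icc : ∀ x, f x ∈ Icc 0 L
  bottom_mem : ∀ i, ∀ x ∈ Ioo (-w) w, q i + x ∈ Icc 0 L
  up : ∀ i, ∀ x ∈ Ioo (-w) w, f (q i + x) = p i - s * x
  down : ∀ i, ∀ x ∈ Ioo (-w) w, f (p i - s * x) = q i + lorenz lam c x
  bottom_disjoint : ∀ i j, ∀ x ∈ Ioo (-w) w, ∀ y ∈ Ioo (-w) w, q i + x = q j + y → i = j
  bottom_ne_top : ∀ i j, ∀ x ∈ Ioo (-w) w, ∀ y ∈ Ioo (-w) w, q i + x ≠ p j - s * y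
  cover : {z ∈ Icc 0 L | ∀ i, ∀ x ∈ Ioo (-w) w, z ≠ q i + x ∧ z ≠ p i - s * x}.Countable

namespace IsLorenzSystem

variable {f : ℝ → ℝ} {L : ℝ} {n : ℕ} {lam c w s : ℝ} {q p : Fin n → ℝ}
  (H : IsLorenzSystem f L lam c w s q p)
include H

/-- On each of the countably many pieces the map is affine or an affine change of a Lorenz map, with
nonzero slopes; a countable remainder affects neither property. -/
theorem measurable_and_absolutelyContinuous (hlam : 1 < lam) :
    Measurable f ∧ (volume.restrict (Icc 0 L)).map f ≪ volume.restrict (Icc 0 L) := by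
  have hs := H.scale_pos
  let S : Fin n ⊕ Fin n → Set ℝ := Sum.elim (fun i => {z | z - q i ∈ Ioo (-w) w})
    (fun i => {z | (p i - z) / s ∈ Ioo (-w) w})
  let g : Fin n ⊕ Fin n → ℝ → ℝ := Sum.elim (fun i z => p i - s * (z - q i))
    (fun i z => q i + lorenz lam c ((p i - z) / s))
  have hS : ∀ i, MeasurableSet (S i) := by
    rintro (i | i)
    · exact (by fun_prop : Measurable fun z => z - q i) measurableSet_Ioo
    · exact (by fun_prop : Measurable fun z => (p i - z) / s) measurableSet_Ioo
  have hg : ∀ i, Measurable (g i) := by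
    rintro (i | i)
    · exact (by fun_prop : Measurable fun z => p i - s * (z - q i))
    · exact ((measurable_lorenz lam c).comp
        (by fun_prop : Measurable fun z => (p i - z) / s)).const_add (q i)
  have hfg : ∀ i, EqOn f (g i) (S i) := by
    rintro (i | i) z hz
    · have := H.up i _ hz
      rwa [add_sub_cancel] at this
    · have := H.down i _ hz
      rwa [mul_div_cancel₀ _ hs.ne', sub_sub_cancel] at this
  have hnull : ∀ i A, volume A = 0 → volume (g i ⁻¹' A) = 0 := by
    rintro (i | i) A hA
    · have : g (Sum.inl i) = fun z => -s * z + (p i + s * q i) := by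
        funext z; simp only [g, Sum.elim_inl]; ring
      rw [this]
      exact volume_preimage_affine_eq_zero (neg_ne_zero.2 hs.ne') _ hA
    · have h1 : volume ((fun z => 1 * z + q i) ⁻¹' A) = 0 :=
        volume_preimage_affine_eq_zero one_ne_zero _ hA
      have h2 := volume_preimage_lorenz_eq_zero (by linarith : lam ≠ 0) c h1
      have h3 := volume_preimage_affine_eq_zero (neg_ne_zero.2 (inv_ne_zero hs.ne')) (p i / s) h2
      convert h3 using 2
      ext z
      simp only [g, Sum.elim_inr, mem_preimage]
      have : -s⁻¹ * z + p i / s = (p i - z) / s := by field_simp; ring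
      rw [this, one_mul, add_comm]
  have hcov : (Icc 0 L \ ⋃ i, S i).Countable := by
    refine H.cover.mono ?_
    intro z hz
    refine ⟨hz.1, fun i x hx => ⟨?_, ?_⟩⟩
    · rintro rfl
      refine hz.2 (mem_iUnion.2 ⟨Sum.inl i, ?_⟩)
      change _ ∈ {z | z - q i ∈ Ioo (-w) w}
      rwa [mem_ofPred_eq, add_sub_cancel_left]
    · rintro rfl
      refine hz.2 (mem_iUnion.2 ⟨Sum.inr i, ?_⟩)
      have : (p i - (p i - s * x)) / s = x := by field_simp; ring
      change _ ∈ {z | (p i - z) / s ∈ Ioo (-w) w}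
      rwa [mem_ofPred_eq, this]
  have hmeas : Measurable f := by
    -- The index `none` stands for the complement of `[0, L]`, where the map is zero.
    refine measurable_of_eqOn_cover (S := fun o : Option (Fin n ⊕ Fin n) => o.elim (Icc 0 L)ᶜ S)
      (g := fun o => o.elim (fun _ => 0) g) ?_ ?_ ?_ (hcov.mono ?_)
    · rintro (_ | i)
      exacts [measurableSet_Icc.compl, hS i]
    · rintro (_ | i)
      exacts [measurable_const, hg i]
    · rintro (_ | i)
      exacts [fun z hz => H.eq_zero z hz, hfg i]
    · intro z hz
      rw [mem_compl_iff, mem_iUnion, not_exists] at hz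
      refine ⟨not_not.1 (hz none), fun h => ?_⟩
      obtain ⟨i, hi⟩ := mem_iUnion.1 h
      exact hz (some i) hi
  refine ⟨hmeas, Measure.AbsolutelyContinuous.mk fun B hB hB0 => ?_⟩
  rw [Measure.restrict_apply hB] at hB0
  rw [Measure.map_apply hmeas hB, Measure.restrict_apply (hmeas hB)]
  refine measure_mono_null
    (t := (⋃ i, g i ⁻¹' (B ∩ Icc 0 L)) ∪ (Icc 0 L \ ⋃ i, S i)) ?_
    (measure_union_null (measure_iUnion_null fun i => hnull i _ hB0) (hcov.measure_zero _))
  rintro z ⟨hz, hzL⟩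
  by_cases hzS : z ∈ ⋃ i, S i
  · obtain ⟨i, hi⟩ := mem_iUnion.1 hzS
    refine Or.inl (mem_iUnion.2 ⟨i, ?_⟩)
    rw [mem_preimage, ← hfg i hi]
    exact ⟨hz, H.mem_Icc z⟩
  · exact Or.inr ⟨hzL, hzS⟩

variable (hlam : 1 < lam) (hc : 0 < c) (hcw : c < w) (hw : (lam - 1) * w < c)

omit H in
include hlam hcw hw in
theorem lorenz_mem_Ioo {x : ℝ} (hx : x ∈ Ioo (-w) w) : lorenz lam c x ∈ Ioo (-w) w := by
  rcases le_or_gt x 0 with h | h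
  · rw [lorenz_of_nonpos h]
    constructor <;> nlinarith [hx.1]
  · rw [lorenz_of_pos h]
    constructor <;> nlinarith [hx.2]

include hlam hcw hw in
theorem iterate_bottom (i : Fin n) {x : ℝ} (hx : x ∈ Ioo (-w) w) (t : ℕ) :
    (lorenz lam c)^[t] x ∈ Ioo (-w) w ∧ f^[2 * t] (q i + x) = q i + (lorenz lam c)^[t] x := by
  induction t with
  | zero => exact ⟨hx, rfl⟩
  | succ t ih =>
    rw [Nat.mul_succ, Nat.add_comm (2 * t), iterate_add_apply f, ih.2,
      iterate_succ_apply' (lorenz lam c)]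
    refine ⟨lorenz_mem_Ioo hlam hcw hw ih.1, ?_⟩
    rw [iterate_succ_apply', iterate_one, H.up i _ ih.1, H.down i _ ih.1]

include hlam hcw hw in
-- Odd iterates lie in the intervals around the points `p`, which miss those around the points `q`.
-- This parity is the source of the even mixing period.
theorem eq_of_iterate_bottom_eq (i j : Fin n) {x : ℝ} (hx : x ∈ Ioo (-w) w) (r : ℕ)
    {y : ℝ} (hy : y ∈ Ioo (-w) w) (hxy : f^[r] (q i + x) = q j + y) :
    i = j ∧ ∃ t, r = 2 * t ∧ (lorenz lam c)^[t] x = y := by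
  obtain ⟨t, rfl | rfl⟩ := r.even_or_odd'
  · obtain ⟨h1, h2⟩ := H.iterate_bottom hlam hcw hw i hx t
    rw [h2] at hxy
    have hij := H.bottom_disjoint i j _ h1 _ hy hxy
    subst hij
    exact ⟨rfl, t, rfl, add_left_cancel hxy⟩
  · obtain ⟨h1, h2⟩ := H.iterate_bottom hlam hcw hw i hx t
    rw [iterate_succ_apply', h2, H.up i _ h1] at hxy
    exact absurd hxy.symm (H.bottom_ne_top j i _ hy _ h1)

variable {m : ℕ} (hm : lam ^ 2 ^ m = 2)

omit H in
include hlam hc hcw hm in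
theorem renormInterval_subset_Ioo {k : ℕ} (hk : k ≤ m) :
    Ioc (-renormWidth lam c k) (renormWidth lam c k) ⊆ Ioo (-w) w := by
  induction k with
  | zero =>
    rw [renormWidth]
    exact fun x hx => ⟨by linarith [hx.1], lt_of_le_of_lt hx.2 hcw⟩
  | succ k ih => exact (renormInterval_subset hlam hm hc hk).trans (ih (Nat.le_of_succ_le hk))

omit H in
theorem circleParam_eq_add (κ : ℝ) (i : Fin n) (z : UnitAddCircle) :
    circleParam (q i - κ) (2 * κ) z = q i + circleParam (-κ) (2 * κ) z := by
  unfold circleParam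
  ring

omit H in
theorem range_circleParam_sub {κ : ℝ} (hκ : 0 < κ) (i : Fin n) :
    range (circleParam (q i - κ) (2 * κ)) = {z | z - q i ∈ Ioc (-κ) κ} := by
  rw [range_circleParam _ (by linarith)]
  ext z
  constructor
  · rintro ⟨h1, h2⟩
    exact ⟨by linarith, by linarith⟩
  · rintro ⟨h1, h2⟩
    exact ⟨by linarith, by linarith⟩

include hlam hc hcw hw hm

theorem iterate_mem_base {i j : Fin n} {r : ℕ} {z : UnitAddCircle}
    (hr : f^[r] (circleParam (q i - renormWidth lam c m) (2 * renormWidth lam c m) z)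
      ∈ range (circleParam (q j - renormWidth lam c m) (2 * renormWidth lam c m))) :
    i = j ∧ ¬ (0 < r ∧ r < 2 * 2 ^ m) := by
  have hκ := renormWidth_pos hlam hc m
  have hsub := renormInterval_subset_Ioo hlam hc hcw hm le_rfl
  set κ := renormWidth lam c m
  have hx : circleParam (-κ) (2 * κ) z ∈ Ioc (-κ) κ := by
    have := mem_range_self (f := circleParam (-κ) (2 * κ)) z
    rw [range_circleParam _ (by linarith)] at this
    exact ⟨this.1, by linarith [this.2]⟩
  rw [range_circleParam_sub hκ, circleParam_eq_add] at hr
  obtain ⟨hij, t, rfl, ht⟩ := H.eq_of_iterate_bottom_eq hlam hcw hw i j (hsub hx) r (hsub hr)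
    (by ring)
  refine ⟨hij, fun h => ?_⟩
  refine lorenz_iterate_notMem hlam hm hc le_rfl hx (r := t) (by omega) (by omega) ?_
  rw [ht]
  exact hr

theorem isDoublingTower (i : Fin n) :
    IsDoublingTower f (2 * 2 ^ m)
      (circleParam (q i - renormWidth lam c m) (2 * renormWidth lam c m)) where
  pos := by positivity
  measurable_map := (H.measurable_and_absolutelyContinuous hlam).1
  measurable := measurable_circleParam _ _
  measurableSet_range := by
    rw [range_circleParam _ (by linarith [renormWidth_pos hlam hc m])]
    exact measurableSet_Ioc
  semiconj z := by
    have hκ := renormWidth_pos hlam hc m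
    have hsub := renormInterval_subset_Ioo hlam hc hcw hm le_rfl
    have hx : circleParam (-renormWidth lam c m) (2 * renormWidth lam c m) z
        ∈ Ioc (-renormWidth lam c m) (renormWidth lam c m) := by
      have := mem_range_self (f := circleParam (-renormWidth lam c m) (2 * renormWidth lam c m)) z
      rw [range_circleParam _ (by linarith)] at this
      exact ⟨this.1, by linarith [this.2]⟩
    rw [circleParam_eq_add, circleParam_eq_add,
      (H.iterate_bottom hlam hcw hw i (hsub hx) _).2,
      lorenz_iterate_two_pow hlam hm hc le_rfl hx, hm, lorenz_two_circleParam hκ]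
  first_return z r hr hrk hmem :=
    (H.iterate_mem_base hlam hc hcw hw hm hmem).2 ⟨hr, hrk⟩

/-- Mass is followed from `[0, L]` to one bottom interval, then to `(-c, c]` around its centre, then
through the successive renormalisation intervals. Only countable sets are lost on the way, and `ν`
does not see them. -/
theorem exists_measure_base_ne_zero {ν : Measure ℝ} [IsProbabilityMeasure ν]
    (hν : MeasurePreserving f ν ν) (hac : ν ≪ volume.restrict (Icc 0 L)) :
    ∃ i, ν (range (circleParam (q i - renormWidth lam c m) (2 * renormWidth lam c m))) ≠ 0 := by
  have hvol : ν ≪ volume := hac.trans Measure.restrict_le_self.absolutelyContinuous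
  have hcount : ∀ E : Set ℝ, E.Countable → ν E = 0 := fun E hE => hvol (hE.measure_zero _)
  have hIoo : ∀ i : Fin n, MeasurableSet {z | z - q i ∈ Ioo (-w) w} := fun i =>
    (by fun_prop : Measurable fun z => z - q i) measurableSet_Ioo
  have hIoc : ∀ (i : Fin n) κ, MeasurableSet {z | z - q i ∈ Ioc (-κ) κ} := fun i κ =>
    (by fun_prop : Measurable fun z => z - q i) measurableSet_Ioc
  have hbottom : ∃ i, ν {z | z - q i ∈ Ioo (-w) w} ≠ 0 := by
    have hU : ν (⋃ i, {z | z - q i ∈ Ioo (-w) w}) ≠ 0 := by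
      refine measure_ne_zero_of_forall_exists_iterate_mem hν (S := Icc 0 L)
        (E := {z ∈ Icc 0 L | ∀ i, ∀ x ∈ Ioo (-w) w, z ≠ q i + x ∧ z ≠ p i - s * x}) ?_
        (MeasurableSet.iUnion hIoo) (hcount _ H.cover) ?_
      · have : ν (Icc 0 L)ᶜ = 0 := hac (by
          rw [Measure.restrict_apply measurableSet_Icc.compl, compl_inter_self, measure_empty])
        rw [prob_compl_eq_zero_iff measurableSet_Icc] at this
        rw [this]
        exact one_ne_zero
      · intro z hz hzE
        have : ∃ i, ∃ x ∈ Ioo (-w) w, z = q i + x ∨ z = p i - s * x := by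
          by_contra! hcon
          exact hzE ⟨hz, hcon⟩
        obtain ⟨i, x, hx, rfl | rfl⟩ := this
        · exact ⟨0, mem_iUnion.2 ⟨i, by rwa [iterate_zero, id, mem_ofPred_eq, add_sub_cancel_left]⟩⟩
        · refine ⟨1, mem_iUnion.2 ⟨i, ?_⟩⟩
          rw [iterate_one, H.down i x hx, mem_ofPred_eq, add_sub_cancel_left]
          exact lorenz_mem_Ioo hlam hcw hw hx
    by_contra! hcon
    exact hU (measure_iUnion_null hcon)
  obtain ⟨i, hi⟩ := hbottom
  refine ⟨i, ?_⟩
  rw [range_circleParam_sub (renormWidth_pos hlam hc m)]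
  have key : ∀ k ≤ m, ν {z | z - q i ∈ Ioc (-renormWidth lam c k) (renormWidth lam c k)} ≠ 0 := by
    intro k hk
    induction k with
    | zero =>
      refine measure_ne_zero_of_forall_exists_iterate_mem hν hi (hIoc i _)
        (measure_empty (μ := ν)) ?_
      intro z hz _
      obtain ⟨t, ht⟩ := exists_lorenz_iterate_mem hlam hc hcw hw hz
      refine ⟨2 * t, ?_⟩
      have := (H.iterate_bottom hlam hcw hw i hz t).2
      rw [add_sub_cancel] at this
      rw [this, mem_ofPred_eq, add_sub_cancel_left]
      exact ht
    | succ k ih =>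
      have hk' : k < m := hk
      -- The orbit of period two of the map renormalised `k` times never enters the next interval.
      set a := renormWidth lam c k / (lam ^ 2 ^ k + 1)
      refine measure_ne_zero_of_forall_exists_iterate_mem hν (ih hk'.le) (hIoc i _)
        (E := {q i + a, q i - a}) (hcount _ (Set.toFinite _).countable) ?_
      intro z hz hzE
      rw [mem_insert_iff, mem_singleton_iff, not_or] at hzE
      obtain ⟨t, ht⟩ := exists_lorenz_iterate_mem_succ hlam hm hc hk' (x := z - q i) hz
        (fun h => hzE.1 (by linarith)) (fun h => hzE.2 (by linarith))
      refine ⟨2 * t, ?_⟩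
      have hz' := renormInterval_subset_Ioo hlam hc hcw hm hk'.le hz
      have := (H.iterate_bottom hlam hcw hw i hz' t).2
      rw [add_sub_cancel] at this
      rw [this, mem_ofPred_eq, add_sub_cancel_left]
      exact ht
  exact key m le_rfl

theorem isErgodicAcip_iff (ν : Measure ℝ) :
    (IsProbabilityMeasure ν ∧ ν ≪ volume.restrict (Icc 0 L) ∧ Ergodic f ν) ↔
      ν ∈ range fun i => towerMeasure f (2 * 2 ^ m)
        (circleParam (q i - renormWidth lam c m) (2 * renormWidth lam c m)) := by
  have hκ := renormWidth_pos hlam hc m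
  constructor
  · rintro ⟨hprob, hac, herg⟩
    obtain ⟨i, hi⟩ := H.exists_measure_base_ne_zero hlam hc hcw hw hm herg.toMeasurePreserving hac
    refine ⟨i, ?_⟩
    refine ((H.isDoublingTower hlam hc hcw hw hm i).eq_towerMeasure herg hi
      (measurable_circleCoord _ _) (circleCoord_circleParam _ (by positivity)) ?_).symm
    exact map_circleCoord_absolutelyContinuous _ (by positivity)
      (hac.trans Measure.restrict_le_self.absolutelyContinuous)
  · rintro ⟨i, rfl⟩
    have hT := H.isDoublingTower hlam hc hcw hw hm i
    refine ⟨hT.isProbabilityMeasure, ?_, hT.ergodic⟩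
    refine hT.towerMeasure_absolutelyContinuous
      (H.measurable_and_absolutelyContinuous hlam).2 ?_
    refine (map_circleParam_absolutelyContinuous _ (by positivity)).trans
      (Measure.restrict_mono_set _ ?_).absolutelyContinuous
    rw [← range_circleParam _ (by positivity), range_circleParam_sub hκ]
    intro z hz
    have := H.bottom_mem i _ (renormInterval_subset_Ioo hlam hc hcw hm le_rfl hz)
    rwa [add_sub_cancel] at this

/-- An orbit from base `i` never meets base `j ≠ i`, so the tower measure of `i` vanishes on level 0
of tower `j`, to which the measure of tower `j` gives mass `1 / (2 * 2 ^ m)`. -/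
theorem injective_towerMeasure :
    Injective fun i => towerMeasure f (2 * 2 ^ m)
      (circleParam (q i - renormWidth lam c m) (2 * renormWidth lam c m)) := by
  intro i j hij
  have hi := H.isDoublingTower hlam hc hcw hw hm i
  have hj := H.isDoublingTower hlam hc hcw hw hm j
  by_contra hne
  have hnull : towerMeasure f (2 * 2 ^ m)
      (circleParam (q i - renormWidth lam c m) (2 * renormWidth lam c m))
      (towerLevel f (2 * 2 ^ m)
        (circleParam (q j - renormWidth lam c m) (2 * renormWidth lam c m)) 0) = 0 := by
    have := hi.ae_of_forall (hj.measurableSet_towerLevel 0).compl (fun l _ z hz => by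
      rw [towerLevel, mem_preimage, ← iterate_add_apply] at hz
      exact hne (H.iterate_mem_base hlam hc hcw hw hm hz).1)
    rw [ae_iff] at this
    simpa using this
  have hij' : towerMeasure f (2 * 2 ^ m)
      (circleParam (q i - renormWidth lam c m) (2 * renormWidth lam c m))
      = towerMeasure f (2 * 2 ^ m)
        (circleParam (q j - renormWidth lam c m) (2 * renormWidth lam c m)) := hij
  rw [hij'] at hnull
  have hres := hj.restrict_towerLevel hj.pos
  rw [Measure.restrict_eq_zero.2 hnull] at hres
  have := congrArg (fun μ : Measure ℝ => μ univ) hres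
  rw [Measure.smul_apply, Measure.map_apply (hj.measurable_level 0) MeasurableSet.univ] at this
  simp only [preimage_univ, UnitAddCircle.measure_univ, smul_eq_mul, mul_one,
    Measure.coe_zero, Pi.zero_apply] at this
  exact ENNReal.inv_ne_zero.2 (ENNReal.natCast_ne_top _) this.symm

end IsLorenzSystem

/-! ### The slap map of a convex polygon -/

section Cross

theorem cross_self (u : Plane) : cross u u = 0 := by
  simp only [cross]; ring

theorem cross_zero_left (u : Plane) : cross 0 u = 0 := by simp [cross]

theorem cross_zero_right (u : Plane) : cross u 0 = 0 := by simp [cross]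

/-- The values of the affine function `p ↦ cross u (p - v)` along a line. -/
theorem cross_lineMap (u v a b : Plane) (r : ℝ) :
    cross u (a + r • (b - a) - v) = (1 - r) * cross u (a - v) + r * cross u (b - v) := by
  simp only [cross, PiLp.add_apply, PiLp.smul_apply, PiLp.sub_apply, smul_eq_mul]; ring

end Cross

variable {d : ℕ} {P : Polygon Plane d}

/-- The signed area function of the side `k`: it is positive on the left of the side. -/
noncomputable def sideForm (P : Polygon Plane d) (k : Fin d) (p : Plane) : ℝ :=
  cross (P.vertices (finRotate d k) - P.vertices k) (p - P.vertices k)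

theorem sideForm_lineMap (k : Fin d) (a b : Plane) (r : ℝ) :
    sideForm P k (a + r • (b - a)) = (1 - r) * sideForm P k a + r * sideForm P k b :=
  cross_lineMap _ _ _ _ _

theorem sideForm_left (k : Fin d) : sideForm P k (P.vertices k) = 0 := by
  rw [sideForm, sub_self, cross_zero_right]

theorem sideForm_right (k : Fin d) : sideForm P k (P.vertices (finRotate d k)) = 0 :=
  cross_self _

theorem sideInterval_eq (i : Fin d) :
    sideInterval P i = Ico (sideStart P i) (sideStart P i + sideLength P i) := rfl

theorem mem_boundary_iff {p : Plane} : p ∈ P.boundary ℝ ↔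
    ∃ k, ∃ r ∈ Icc (0 : ℝ) 1,
      p = P.vertices k + r • (P.vertices (finRotate d k) - P.vertices k) := by
  rw [Polygon.boundary, mem_iUnion]
  refine exists_congr fun k => ?_
  have hne : NeZero d := k.neZero
  rw [Polygon.edgeSet, affineSegment, mem_image]
  refine exists_congr fun r => and_congr_right fun _ => ?_
  rw [AffineMap.lineMap_apply_module', finRotate_apply, add_comm, eq_comm]

theorem exists_sideForm_eq_zero {p : Plane} (hp : p ∈ P.boundary ℝ) :
    ∃ k, sideForm P k p = 0 := by
  obtain ⟨k, r, -, rfl⟩ := mem_boundary_iff.1 hp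
  exact ⟨k, by rw [sideForm_lineMap, sideForm_left, sideForm_right]; ring⟩

theorem sidePoint_eq (i : Fin d) (s : ℝ) : sidePoint P i s = P.vertices i +
    ((s - sideStart P i) / sideLength P i) • (P.vertices (finRotate d i) - P.vertices i) := by
  rw [sidePoint, sideDir, smul_smul, div_eq_mul_inv]

/-! ### Arc length: the side intervals partition `[0, L)`. -/

section Start

theorem sideLength_nonneg (i : Fin d) : 0 ≤ sideLength P i := dist_nonneg

theorem sideStart_nonneg (i : Fin d) : 0 ≤ sideStart P i :=
  Finset.sum_nonneg fun _ _ => sideLength_nonneg _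

theorem sideStart_add (i : Fin d) :
    sideStart P i + sideLength P i = ∑ j ∈ Finset.Iic i, sideLength P j := by
  rw [sideStart, ← Finset.Iio_insert, Finset.sum_insert (by simp), add_comm]

theorem sideStart_add_le_perimeter (i : Fin d) : sideStart P i + sideLength P i ≤ perimeter P := by
  rw [sideStart_add]
  exact Finset.sum_le_univ_sum_of_nonneg fun _ => sideLength_nonneg _

theorem sideStart_add_le {i j : Fin d} (hij : i < j) :
    sideStart P i + sideLength P i ≤ sideStart P j := by
  rw [sideStart_add]
  refine Finset.sum_le_sum_of_subset_of_nonneg ?_ fun _ _ _ => sideLength_nonneg _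
  intro k hk
  rw [Finset.mem_Iic] at hk
  exact Finset.mem_Iio.2 (lt_of_le_of_lt hk hij)

theorem sideStart_succ {i j : Fin d} (hij : (j : ℕ) = i + 1) :
    sideStart P j = sideStart P i + sideLength P i := by
  rw [sideStart_add, sideStart]
  congr 1
  ext k
  rw [Finset.mem_Iio, Finset.mem_Iic, Fin.lt_def, Fin.le_def, hij, Nat.lt_succ_iff]

theorem eq_of_mem_sideInterval {i j : Fin d} {s : ℝ} (hi : s ∈ sideInterval P i)
    (hj : s ∈ sideInterval P j) : i = j := by
  rw [sideInterval_eq] at hi hj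
  rcases lt_trichotomy i j with h | h | h
  · linarith [sideStart_add_le (P := P) h, hi.2, hj.1]
  · exact h
  · linarith [sideStart_add_le (P := P) h, hj.2, hi.1]

theorem sideInterval_subset (i : Fin d) : sideInterval P i ⊆ Ico 0 (perimeter P) := fun _ hs =>
  ⟨(sideStart_nonneg i).trans hs.1, hs.2.trans_le (sideStart_add_le_perimeter i)⟩

theorem exists_mem_sideInterval {s : ℝ} (hs : s ∈ Ico 0 (perimeter P)) :
    ∃ i, s ∈ sideInterval P i := by
  have hd : 0 < d := by
    rcases Nat.eq_zero_or_pos d with rfl | h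
    · have : perimeter P = 0 := by simp [perimeter]
      linarith [hs.1, hs.2]
    · exact h
  have hne : (Finset.univ.filter fun i : Fin d => sideStart P i ≤ s).Nonempty := by
    refine ⟨⟨0, hd⟩, Finset.mem_filter.2 ⟨Finset.mem_univ _, ?_⟩⟩
    have : sideStart P ⟨0, hd⟩ = 0 := by
      rw [sideStart]
      refine Finset.sum_eq_zero fun k hk => ?_
      rw [Finset.mem_Iio, Fin.lt_def] at hk
      simp at hk
    rw [this]
    exact hs.1
  obtain ⟨i, hi, hmax⟩ := Finset.exists_max_image _ (fun i : Fin d => i) hne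
  refine ⟨i, (Finset.mem_filter.1 hi).2, ?_⟩
  by_contra! hle
  by_cases hlast : (i : ℕ) + 1 < d
  · have h1 := hmax ⟨i + 1, hlast⟩ (Finset.mem_filter.2 ⟨Finset.mem_univ _, by
      rw [sideStart_succ (i := i) rfl]; exact hle⟩)
    rw [Fin.le_def] at h1
    simp at h1
  · have : perimeter P = sideStart P i + sideLength P i := by
      rw [sideStart_add, perimeter]
      congr 1
      ext k
      simp only [Finset.mem_univ, Finset.mem_Iic, Fin.le_def, true_iff]
      omega
    linarith [hs.2]

end Start

/-! ### Convexity: points of the sides, chords and slap images. -/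

section Convex

variable (hP : IsConvexPolygon P)
include hP

theorem sideForm_pos {k j : Fin d} (h1 : j ≠ k) (h2 : j ≠ finRotate d k) :
    0 < sideForm P k (P.vertices j) := hP.2 k j h1 h2

theorem sideForm_vertex_nonneg (k j : Fin d) : 0 ≤ sideForm P k (P.vertices j) := by
  by_cases h1 : j = k
  · rw [h1, sideForm_left]
  · by_cases h2 : j = finRotate d k
    · rw [h2, sideForm_right]
    · exact (sideForm_pos hP h1 h2).le

theorem finRotate_ne_self (k : Fin d) : finRotate d k ≠ k := by
  intro h
  have h1 := val_finRotate k
  rw [h] at h1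
  have := hP.1
  split_ifs at h1 <;> omega

theorem finRotate_finRotate_ne_self (k : Fin d) : finRotate d (finRotate d k) ≠ k := by
  intro h
  have h1 := val_finRotate k
  have h2 := val_finRotate (finRotate d k)
  rw [h] at h2
  have := hP.1
  have := k.2
  by_cases h3 : (k : ℕ) + 1 = d
  · rw [if_pos h3] at h1
    rw [h1] at h2
    split_ifs at h2 <;> omega
  · rw [if_neg h3] at h1
    rw [h1] at h2
    split_ifs at h2 <;> omega

theorem sideLength_pos (i : Fin d) : 0 < sideLength P i := by
  refine dist_pos.2 fun h => ?_
  have h1 : finRotate d (finRotate d i) ≠ finRotate d i := finRotate_ne_self hP _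
  have := hP.2 i _ (finRotate_finRotate_ne_self hP i) h1
  rw [← h, sub_self, cross_zero_left] at this
  exact lt_irrefl _ this

theorem sidePoint_ratio_mem {i : Fin d} {s : ℝ} (hs : s ∈ sideInterval P i) :
    (s - sideStart P i) / sideLength P i ∈ Ico (0 : ℝ) 1 := by
  have h := sideLength_pos hP i
  exact ⟨div_nonneg (by linarith [hs.1]) h.le, (div_lt_one h).2 (by linarith [hs.2])⟩

theorem sidePoint_mem_boundary {i : Fin d} {s : ℝ} (hs : s ∈ sideInterval P i) :
    sidePoint P i s ∈ P.boundary ℝ :=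
  mem_boundary_iff.2 ⟨i, _, Ico_subset_Icc_self (sidePoint_ratio_mem hP hs), sidePoint_eq i s⟩

theorem sideForm_sidePoint_nonneg (k : Fin d) {i : Fin d} {s : ℝ} (hs : s ∈ sideInterval P i) :
    0 ≤ sideForm P k (sidePoint P i s) := by
  have h := sidePoint_ratio_mem hP hs
  rw [sidePoint_eq, sideForm_lineMap]
  exact add_nonneg (mul_nonneg (by linarith [h.2]) (sideForm_vertex_nonneg hP k i))
    (mul_nonneg h.1 (sideForm_vertex_nonneg hP k _))

/-- At least one endpoint of another side is off the line of side `k`, and an interior point gives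
both endpoints positive weight. -/
theorem sideForm_sidePoint_pos {k i : Fin d} (hik : i ≠ k) {s : ℝ}
    (hs : s ∈ Ioo (sideStart P i) (sideStart P i + sideLength P i)) :
    0 < sideForm P k (sidePoint P i s) := by
  have h := sidePoint_ratio_mem hP (Ioo_subset_Ico_self hs)
  have h0 : 0 < (s - sideStart P i) / sideLength P i :=
    div_pos (by linarith [hs.1]) (sideLength_pos hP i)
  rw [sidePoint_eq, sideForm_lineMap]
  have h1 := sideForm_vertex_nonneg hP k i
  have h2 := sideForm_vertex_nonneg hP k (finRotate d i)
  by_cases hi : i = finRotate d k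
  · have h3 : 0 < sideForm P k (P.vertices (finRotate d i)) := by
      refine sideForm_pos hP ?_ ?_
      · rw [hi]
        exact finRotate_finRotate_ne_self hP k
      · rw [← hi]
        exact finRotate_ne_self hP i
    exact add_pos_of_nonneg_of_pos (mul_nonneg (by linarith [h.2]) h1) (mul_pos h0 h3)
  · exact add_pos_of_pos_of_nonneg (mul_pos (by linarith [h.2]) (sideForm_pos hP hik hi))
      (mul_nonneg h.1 h2)

theorem sidePoint_injOn {i j : Fin d} {s s' : ℝ} (hs : s ∈ sideInterval P i)
    (hs' : s' ∈ sideInterval P j) (h : sidePoint P i s = sidePoint P j s') : s = s' := by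
  -- Since sides omit their last endpoint, two different sides sharing a point would each have to
  -- follow the other, which fails for `d ≥ 3`.
  have key : ∀ {i j : Fin d} {s s' : ℝ}, s ∈ sideInterval P i → s' ∈ sideInterval P j →
      sidePoint P i s = sidePoint P j s' → i ≠ j → i = finRotate d j := by
    intro i j s s' hs hs' h hij
    by_contra hne
    have h0 := sidePoint_ratio_mem hP hs
    have h1 : sideForm P j (sidePoint P i s) = 0 := by
      rw [h, sidePoint_eq, sideForm_lineMap, sideForm_left, sideForm_right]
      ring
    have h2 : 0 < sideForm P j (sidePoint P i s) := by
      rw [sidePoint_eq, sideForm_lineMap]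
      exact add_pos_of_pos_of_nonneg (mul_pos (by linarith [h0.2]) (sideForm_pos hP hij hne))
        (mul_nonneg h0.1 (sideForm_vertex_nonneg hP _ _))
    exact h2.ne' h1
  by_cases hij : i = j
  · subst hij
    have hL := sideLength_pos hP i
    have hne : P.vertices (finRotate d i) - P.vertices i ≠ 0 :=
      sub_ne_zero.2 fun h' => (dist_pos.1 hL) h'.symm
    rw [sidePoint_eq, sidePoint_eq, add_right_inj] at h
    have := smul_left_injective ℝ hne h
    rw [div_left_inj' hL.ne'] at this
    linarith
  · have h1 := key hs hs' h hij
    have h2 := key hs' hs h.symm (Ne.symm hij)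
    rw [h1] at h2
    exact absurd h2.symm (finRotate_finRotate_ne_self hP j)

theorem IsSlapImage.unique {s s₁ s₂ : ℝ} (h₁ : IsSlapImage P s s₁) (h₂ : IsSlapImage P s s₂) :
    s₁ = s₂ := by
  obtain ⟨i, j, hs, hj, t, ht, hp, hr⟩ := h₁
  obtain ⟨i', j', hs', hj', t', ht', hp', hr'⟩ := h₂
  obtain rfl := eq_of_mem_sideInterval hs hs'
  rcases lt_trichotomy t t' with h | h | h
  · exact absurd (hp ▸ sidePoint_mem_boundary hP hj) (hr' t ⟨ht, h⟩)
  · subst h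
    exact sidePoint_injOn hP hj hj' (hp.trans hp'.symm)
  · exact absurd (hp' ▸ sidePoint_mem_boundary hP hj') (hr t' ⟨ht', h⟩)

theorem IsSlapImage.slapMap_eq {s s' : ℝ} (h : IsSlapImage P s s') : slapMap P s = s' := by
  have hex : ∃ s', IsSlapImage P s s' := ⟨s', h⟩
  rw [slapMap, dif_pos hex]
  exact IsSlapImage.unique hP hex.choose_spec h

theorem slapMap_mem_Icc (s : ℝ) : slapMap P s ∈ Icc 0 (perimeter P) := by
  by_cases hex : ∃ s', IsSlapImage P s s'
  · obtain ⟨s', h⟩ := hex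
    rw [h.slapMap_eq hP]
    obtain ⟨i, j, -, hj, -⟩ := h
    exact Ico_subset_Icc_self (sideInterval_subset j hj)
  · rw [slapMap, dif_neg hex]
    exact ⟨le_rfl, Finset.sum_nonneg fun _ _ => sideLength_nonneg _⟩

omit hP in
theorem slapMap_eq_zero {s : ℝ} (hs : s ∉ Icc 0 (perimeter P)) : slapMap P s = 0 := by
  rw [slapMap, dif_neg]
  rintro ⟨s', i, j, hi, -⟩
  exact hs (Ico_subset_Icc_self (sideInterval_subset i hi))

/-- The open chord between an interior point of the side `b` and a boundary point that is not on
the line of this side does not meet the boundary. -/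
theorem notMem_boundary_of_chord {b i : Fin d} {s s' : ℝ}
    (hs : s ∈ Ioo (sideStart P b) (sideStart P b + sideLength P b)) (hs' : s' ∈ sideInterval P i)
    (hpos : 0 < sideForm P b (sidePoint P i s')) {r : ℝ} (hr : r ∈ Ioo (0 : ℝ) 1) :
    sidePoint P b s + r • (sidePoint P i s' - sidePoint P b s) ∉ P.boundary ℝ := by
  intro hmem
  -- A boundary point annihilates some side form, but each form is affine and nonnegative on the
  -- chord and positive at one of its ends: at the far end for `k = b`, at the starting end
  -- otherwise.
  obtain ⟨k, hk⟩ := exists_sideForm_eq_zero hmem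
  rw [sideForm_lineMap] at hk
  have h1 : 0 < 1 - r := by linarith [hr.2]
  by_cases hkb : b = k
  · subst hkb
    have h2 := sideForm_sidePoint_nonneg hP b (Ioo_subset_Ico_self hs : s ∈ sideInterval P b)
    nlinarith [mul_nonneg h1.le h2, mul_pos hr.1 hpos]
  · have h2 := sideForm_sidePoint_pos hP hkb hs
    have h3 := sideForm_sidePoint_nonneg hP k hs'
    nlinarith [mul_nonneg hr.1.le h3, mul_pos h1 h2]

theorem slapMap_eq_of_chord_start {b i : Fin d} {s s' t : ℝ}
    (hs : s ∈ Ioo (sideStart P b) (sideStart P b + sideLength P b)) (hs' : s' ∈ sideInterval P i)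
    (hpos : 0 < sideForm P b (sidePoint P i s')) (ht : 0 < t)
    (h : sidePoint P i s' = sidePoint P b s + t • inwardNormal P b) : slapMap P s = s' := by
  refine IsSlapImage.slapMap_eq hP ⟨b, i, Ioo_subset_Ico_self hs, hs', t, ht, h, fun r hr => ?_⟩
  have hrt : r / t ∈ Ioo (0 : ℝ) 1 := ⟨div_pos hr.1 ht, (div_lt_one ht).2 hr.2⟩
  have := notMem_boundary_of_chord hP hs hs' hpos hrt
  rwa [h, add_sub_cancel_left, smul_smul, div_mul_cancel₀ _ ht.ne'] at this

/-- The same chord run backwards. Only its end on side `b` has to be interior, so the starting point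
may be a vertex, such as the apex of a roof. -/
theorem slapMap_eq_of_chord_end {b i : Fin d} {s s' t : ℝ}
    (hs : s ∈ Ioo (sideStart P b) (sideStart P b + sideLength P b)) (hs' : s' ∈ sideInterval P i)
    (hpos : 0 < sideForm P b (sidePoint P i s')) (ht : 0 < t)
    (h : sidePoint P b s = sidePoint P i s' + t • inwardNormal P i) : slapMap P s' = s := by
  refine IsSlapImage.slapMap_eq hP ⟨i, b, hs', Ioo_subset_Ico_self hs, t, ht, h, fun r hr => ?_⟩
  have hrt : 1 - r / t ∈ Ioo (0 : ℝ) 1 :=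
    ⟨by linarith [(div_lt_one ht).2 hr.2], by linarith [div_pos hr.1 ht]⟩
  have := notMem_boundary_of_chord hP hs hs' hpos hrt
  rw [h] at this
  convert this using 2
  have hr' : r = (r / t) * t := by field_simp
  rw [sub_add_cancel_left, smul_neg, smul_smul, add_assoc, ← sub_eq_add_neg, ← sub_smul]
  congr 2
  linear_combination hr'

end Convex

/-! ### Coordinates in rotated frames -/

/-- The point with coordinates `(X, Y)` in the frame rotated by `θ + π / 2`. -/
noncomputable def frame (θ X Y : ℝ) : Plane :=
  !₂[-X * Real.sin θ - Y * Real.cos θ, X * Real.cos θ - Y * Real.sin θ]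

section Frame

variable (θ X Y X' Y' a : ℝ)

theorem frame_sub : frame θ X Y - frame θ X' Y' = frame θ (X - X') (Y - Y') := by
  ext i
  fin_cases i <;> simp [frame] <;> ring

theorem frame_add : frame θ X Y + frame θ X' Y' = frame θ (X + X') (Y + Y') := by
  ext i
  fin_cases i <;> simp [frame] <;> ring

theorem smul_frame : a • frame θ X Y = frame θ (a * X) (a * Y) := by
  ext i
  fin_cases i <;> simp [frame] <;> ring

theorem rotLeft_frame : rotLeft (frame θ X Y) = frame θ (-Y) X := by
  ext i
  fin_cases i
  · simp [frame, rotLeft]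
  · simp [frame, rotLeft]
    ring

theorem cross_frame : cross (frame θ X Y) (frame θ X' Y') = X * Y' - Y * X' := by
  simp only [cross, frame, PiLp.toLp_apply, Matrix.cons_val_zero, Matrix.cons_val_one]
  linear_combination (X * Y' - Y * X') * Real.sin_sq_add_cos_sq θ

theorem dist_frame {ℓ : ℝ} (hℓ : 0 ≤ ℓ) (h : (X' - X) ^ 2 + (Y' - Y) ^ 2 = ℓ ^ 2) :
    dist (frame θ X Y) (frame θ X' Y') = ℓ := by
  rw [EuclideanSpace.dist_eq, ← Real.sqrt_sq hℓ, ← h]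
  congr 1
  simp only [Fin.sum_univ_two, Real.dist_eq, sq_abs, frame, PiLp.toLp_apply,
    Matrix.cons_val_zero, Matrix.cons_val_one]
  linear_combination ((X' - X) ^ 2 + (Y' - Y) ^ 2) * Real.sin_sq_add_cos_sq θ

end Frame

section SideFrame

variable {d : ℕ} {P : Polygon Plane d} {k : Fin d} {θ X₀ Y₀ X₁ Y₁ ℓ : ℝ}
  (h₀ : P.vertices k = frame θ X₀ Y₀) (h₁ : P.vertices (finRotate d k) = frame θ X₁ Y₁)
include h₀ h₁

theorem sideForm_frame (X Y : ℝ) :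
    sideForm P k (frame θ X Y) = (X₁ - X₀) * (Y - Y₀) - (Y₁ - Y₀) * (X - X₀) := by
  rw [sideForm, h₀, h₁, frame_sub, frame_sub, cross_frame]

variable (hℓ : 0 < ℓ) (h : (X₁ - X₀) ^ 2 + (Y₁ - Y₀) ^ 2 = ℓ ^ 2)
include hℓ h

theorem sideLength_frame : sideLength P k = ℓ := by
  rw [sideLength, h₀, h₁]
  exact dist_frame _ _ _ _ _ hℓ.le h

theorem sideDir_frame : sideDir P k = frame θ (ℓ⁻¹ * (X₁ - X₀)) (ℓ⁻¹ * (Y₁ - Y₀)) := by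
  rw [sideDir, sideLength_frame h₀ h₁ hℓ h, h₀, h₁, frame_sub, smul_frame]

theorem inwardNormal_frame :
    inwardNormal P k = frame θ (-(ℓ⁻¹ * (Y₁ - Y₀))) (ℓ⁻¹ * (X₁ - X₀)) := by
  rw [inwardNormal, sideDir_frame h₀ h₁ hℓ h, rotLeft_frame]

theorem sidePoint_frame (u : ℝ) : sidePoint P k (sideStart P k + u)
    = frame θ (X₀ + u * (ℓ⁻¹ * (X₁ - X₀))) (Y₀ + u * (ℓ⁻¹ * (Y₁ - Y₀))) := by
  rw [sidePoint, sideDir_frame h₀ h₁ hℓ h, h₀, add_sub_cancel_left, smul_frame, frame_add]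

end SideFrame

/-! ### Trigonometric inequalities -/

theorem cos_lt_cos_of_lt_two_pi_sub {x y : ℝ} (hy : 0 ≤ y) (hyx : y < x)
    (hx : x < 2 * Real.pi - y) : Real.cos x < Real.cos y := by
  have h := Real.cos_sub_cos x y
  have h1 : 0 < Real.sin ((x + y) / 2) :=
    Real.sin_pos_of_pos_of_lt_pi (by linarith) (by linarith)
  have h2 : 0 < Real.sin ((x - y) / 2) :=
    Real.sin_pos_of_pos_of_lt_pi (by linarith) (by linarith)
  nlinarith [mul_pos h1 h2]

/-- Half of the exterior angle of a regular `2n`-gon. -/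
noncomputable def halfAngle (n : ℕ) : ℝ := Real.pi / (2 * n)

section Angle

variable {n : ℕ} (hn : 2 ≤ n)
include hn

theorem two_mul_halfAngle : 2 * n * halfAngle n = Real.pi := by
  have : (n : ℝ) ≠ 0 := by positivity
  rw [halfAngle]
  field_simp

theorem halfAngle_pos : 0 < halfAngle n := by
  have : (0 : ℝ) < n := by positivity
  rw [halfAngle]
  have := Real.pi_pos
  positivity

theorem halfAngle_lt : halfAngle n < Real.pi / 2 := by
  have h1 := two_mul_halfAngle hn
  have h2 := halfAngle_pos hn
  have h3 : (2 : ℝ) ≤ n := by exact_mod_cast hn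
  nlinarith

theorem cos_halfAngle_pos : 0 < Real.cos (halfAngle n) :=
  Real.cos_pos_of_mem_Ioo ⟨by linarith [halfAngle_pos hn, Real.pi_pos], halfAngle_lt hn⟩

theorem tan_halfAngle_pos : 0 < Real.tan (halfAngle n) :=
  Real.tan_pos_of_pos_of_lt_pi_div_two (halfAngle_pos hn) (halfAngle_lt hn)

theorem exists_reduced_multiple (m : ℤ) : ∃ r : ℕ, r < 4 * n ∧ (4 * n : ℤ) ∣ m - r ∧
    Real.cos (m * halfAngle n) = Real.cos (r * halfAngle n) ∧
    Real.sin (m * halfAngle n) = Real.sin (r * halfAngle n) := by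
  have hpos : (0 : ℤ) < 4 * n := by omega
  have h1 := Int.emod_nonneg m hpos.ne'
  have h2 := Int.emod_lt_of_pos m hpos
  have h3 := Int.emod_add_mul_ediv m (4 * n)
  obtain ⟨r, hr⟩ := Int.eq_ofNat_of_zero_le h1
  rw [hr] at h2 h3
  have h4 : (m : ℝ) * halfAngle n = r * halfAngle n + (m / (4 * n) : ℤ) * (2 * Real.pi) := by
    rw [← two_mul_halfAngle hn, ← h3]
    push_cast
    rw [h3]
    ring
  refine ⟨r, by omega, ⟨m / (4 * n), by linarith⟩, ?_, ?_⟩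
  · rw [h4, Real.cos_add_int_mul_two_pi]
  · rw [h4, Real.sin_add_int_mul_two_pi]

theorem cos_mul_halfAngle_lt {m : ℤ} (h0 : ¬ (4 * n : ℤ) ∣ m) (h1 : ¬ (4 * n : ℤ) ∣ m - 1)
    (h2 : ¬ (4 * n : ℤ) ∣ m + 1) : Real.cos (m * halfAngle n) < Real.cos (halfAngle n) := by
  obtain ⟨r, hr, hdvd, hcos, -⟩ := exists_reduced_multiple hn m
  have hα := halfAngle_pos hn
  have hπ := two_mul_halfAngle hn
  have hr0 : r ≠ 0 := by rintro rfl; exact h0 (by simpa using hdvd)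
  have hr1 : r ≠ 1 := by rintro rfl; exact h1 (by simpa using hdvd)
  have hr2 : r + 1 ≠ 4 * n := by
    intro h
    refine h2 ((dvd_sub_right (dvd_refl _)).1 ?_ : _)
    have : (4 * n : ℤ) - (m + 1) = -(m - r) := by
      have : ((r : ℤ) + 1) = 4 * n := by exact_mod_cast h
      linarith
    rw [this]
    exact (dvd_neg).2 hdvd
  have hlo : (2 : ℝ) ≤ r := by
    have : 2 ≤ r := by omega
    exact_mod_cast this
  have hhi : (r : ℝ) + 2 ≤ 4 * n := by
    have : r + 2 ≤ 4 * n := by omega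
    exact_mod_cast this
  rw [hcos]
  exact cos_lt_cos_of_lt_two_pi_sub hα.le (by nlinarith) (by nlinarith)

/-- With `β = arctan t`, the expression `cos x + t sin x` is `cos (x - β) / cos β`. As `0 < β <
halfAngle n`, among the multiples of `halfAngle n` only those with `m ≡ 0, 1` modulo `4n` are at
most as far from `β` as `halfAngle n` itself. -/
theorem cos_add_mul_sin_lt {t : ℝ} (ht : 0 < t) (htw : t < Real.tan (halfAngle n)) {m : ℤ}
    (h0 : ¬ (4 * n : ℤ) ∣ m) (h1 : ¬ (4 * n : ℤ) ∣ m - 1) :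
    Real.cos (m * halfAngle n) + t * Real.sin (m * halfAngle n)
      < Real.cos (halfAngle n) + t * Real.sin (halfAngle n) := by
  obtain ⟨r, hr, hdvd, hcos, hsin⟩ := exists_reduced_multiple hn m
  have hα := halfAngle_pos hn
  have hα' := halfAngle_lt hn
  have hπ := two_mul_halfAngle hn
  have hr0 : r ≠ 0 := by rintro rfl; exact h0 (by simpa using hdvd)
  have hr1 : r ≠ 1 := by rintro rfl; exact h1 (by simpa using hdvd)
  have hlo : (2 : ℝ) ≤ r := by
    have : 2 ≤ r := by omega
    exact_mod_cast this
  have hhi : (r : ℝ) + 1 ≤ 4 * n := by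
    have : r + 1 ≤ 4 * n := by omega
    exact_mod_cast this
  set β := Real.arctan t
  have hβ0 : 0 < β := Real.arctan_pos.2 ht
  have hβα : β < halfAngle n := by
    rw [← Real.arctan_tan (by linarith : -(Real.pi / 2) < halfAngle n) hα']
    exact Real.arctan_strictMono htw
  have hcβ : 0 < Real.cos β := Real.cos_arctan_pos t
  have hsβ : Real.sin β = t * Real.cos β := by
    have := Real.tan_arctan t
    rw [Real.tan_eq_sin_div_cos, div_eq_iff hcβ.ne'] at this
    exact this
  have hkey : ∀ x, Real.cos (x - β) = Real.cos β * (Real.cos x + t * Real.sin x) := by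
    intro x
    rw [Real.cos_sub, hsβ]
    ring
  rw [hcos, hsin]
  refine lt_of_mul_lt_mul_left ?_ hcβ.le
  rw [← hkey, ← hkey]
  exact cos_lt_cos_of_lt_two_pi_sub (by linarith) (by nlinarith) (by nlinarith)

end Angle

/-! ### The regular `2n`-gon with `n` consecutive sides replaced by shallow roofs -/

/-- The distance to the origin of the vertex in the direction `m * halfAngle n`. -/
noncomputable def roofRadius (n : ℕ) (t : ℝ) (m : ℤ) : ℝ :=
  if Even m then 1 + Real.tan (halfAngle n) * t else (Real.cos (halfAngle n))⁻¹

/-- The direction of the `i`-th vertex, as a multiple of `halfAngle n`. -/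
def roofIndex (n i : ℕ) : ℤ := if i < n then 2 * i - 1 else i + n - 1

/-- The `i`-th vertex. -/
noncomputable def roofVertex (n : ℕ) (t : ℝ) (i : ℕ) : Plane :=
  !₂[roofRadius n t (roofIndex n i) * Real.cos (roofIndex n i * halfAngle n),
    roofRadius n t (roofIndex n i) * Real.sin (roofIndex n i * halfAngle n)]

/-- The regular `2n`-gon of inradius one with `n` consecutive sides replaced by symmetric roofs of
slope `t`. -/
noncomputable def roofPolygon (n : ℕ) (t : ℝ) : Polygon Plane (3 * n) := ⟨fun i => roofVertex n t i⟩

section Roof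

variable {n : ℕ} {t : ℝ}

/-- The angle of the frame in which the side `j` is horizontal and below the origin. -/
noncomputable def roofAngle (n j : ℕ) : ℝ := (2 * j : ℤ) * halfAngle n

theorem roofVertex_eq_frame (j i : ℕ) : roofVertex n t i = frame (roofAngle n j)
    (roofRadius n t (roofIndex n i) * Real.sin ((roofIndex n i - 2 * j : ℤ) * halfAngle n))
    (-(roofRadius n t (roofIndex n i) * Real.cos ((roofIndex n i - 2 * j : ℤ) * halfAngle n))) := by
  have h : (roofIndex n i : ℝ) * halfAngle n
      = (roofIndex n i - 2 * j : ℤ) * halfAngle n + (2 * j : ℤ) * halfAngle n := by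
    push_cast; ring
  rw [roofVertex, h, Real.cos_add, Real.sin_add, frame, roofAngle]
  ext k
  fin_cases k <;> simp <;> ring

variable (hn : 2 ≤ n)
include hn

theorem roofVertex_three_mul : roofVertex n t (3 * n) = roofVertex n t 0 := by
  have h1 : roofIndex n (3 * n) = 4 * n - 1 := by
    rw [roofIndex, if_neg (by omega)]; push_cast; ring
  have h2 : roofIndex n 0 = -1 := by rw [roofIndex, if_pos (by omega)]; norm_num
  have h3 : roofRadius n t (4 * n - 1) = roofRadius n t (-1) := by
    have e1 : ¬ Even (4 * n - 1 : ℤ) := by rw [Int.even_iff]; omega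
    have e2 : ¬ Even (-1 : ℤ) := by rw [Int.even_iff]; omega
    rw [roofRadius, roofRadius, if_neg e1, if_neg e2]
  have h4 : ((4 * n - 1 : ℤ) : ℝ) * halfAngle n
      = ((-1 : ℤ) : ℝ) * halfAngle n + 2 * Real.pi := by
    rw [← two_mul_halfAngle hn]; push_cast; ring
  rw [roofVertex, roofVertex, h1, h2, h3, h4, Real.cos_add_two_pi, Real.sin_add_two_pi]

theorem roofPolygon_vertices_finRotate (k : Fin (3 * n)) :
    (roofPolygon n t).vertices (finRotate (3 * n) k) = roofVertex n t (k + 1) := by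
  change roofVertex n t (finRotate (3 * n) k) = _
  rw [val_finRotate]
  split_ifs with h
  · rw [h, roofVertex_three_mul hn]
  · rfl

omit hn in
theorem inv_cos_mul_sin : (Real.cos (halfAngle n))⁻¹ * Real.sin (halfAngle n)
    = Real.tan (halfAngle n) := by
  rw [Real.tan_eq_sin_div_cos]; ring

theorem inv_cos_mul_cos : (Real.cos (halfAngle n))⁻¹ * Real.cos (halfAngle n) = 1 :=
  inv_mul_cancel₀ (cos_halfAngle_pos hn).ne'

/-- A kept side and its roof are described in one common frame, as a pentagon with corners `(±w,
-1)`, `(±w, 1)` and apex `(0, 1 + wt)`, where `w = tan (halfAngle n)`. -/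
theorem roofVertex_bottom_left {j : ℕ} (hj : j < n) :
    roofVertex n t j = frame (roofAngle n j) (-Real.tan (halfAngle n)) (-1) := by
  have h1 : roofIndex n j = 2 * j - 1 := if_pos hj
  have h2 : ¬ Even (2 * j - 1 : ℤ) := by rw [Int.even_iff]; omega
  have h3 : ((2 * j - 1 - 2 * j : ℤ) : ℝ) * halfAngle n = -halfAngle n := by push_cast; ring
  rw [roofVertex_eq_frame j, h1, h3, roofRadius, if_neg h2, Real.cos_neg, Real.sin_neg,
    inv_cos_mul_cos hn, mul_neg, inv_cos_mul_sin]

theorem roofVertex_bottom_right {j : ℕ} (hj : j < n) :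
    roofVertex n t (j + 1) = frame (roofAngle n j) (Real.tan (halfAngle n)) (-1) := by
  have h1 : roofIndex n (j + 1) = 2 * j + 1 := by
    rw [roofIndex]; push_cast; split_ifs <;> omega
  have h2 : ¬ Even (2 * j + 1 : ℤ) := by rw [Int.even_iff]; omega
  have h3 : ((2 * j + 1 - 2 * j : ℤ) : ℝ) * halfAngle n = halfAngle n := by push_cast; ring
  rw [roofVertex_eq_frame j, h1, h3, roofRadius, if_neg h2, inv_cos_mul_cos hn,
    inv_cos_mul_sin]

theorem roofVertex_top_right (j : ℕ) :
    roofVertex n t (n + 2 * j) = frame (roofAngle n j) (Real.tan (halfAngle n)) 1 := by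
  have h1 : roofIndex n (n + 2 * j) = 2 * j + 2 * n - 1 := by
    rw [roofIndex, if_neg (by omega)]; push_cast; ring
  have h2 : ¬ Even (2 * j + 2 * n - 1 : ℤ) := by rw [Int.even_iff]; omega
  have h3 : ((2 * j + 2 * n - 1 - 2 * j : ℤ) : ℝ) * halfAngle n = Real.pi - halfAngle n := by
    rw [← two_mul_halfAngle hn]; push_cast; ring
  rw [roofVertex_eq_frame j, h1, h3, roofRadius, if_neg h2, Real.cos_pi_sub, Real.sin_pi_sub,
    mul_neg, inv_cos_mul_cos hn, inv_cos_mul_sin, neg_neg]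

theorem roofVertex_apex (j : ℕ) : roofVertex n t (n + 2 * j + 1)
    = frame (roofAngle n j) 0 (1 + Real.tan (halfAngle n) * t) := by
  have h1 : roofIndex n (n + 2 * j + 1) = 2 * j + 2 * n := by
    rw [roofIndex, if_neg (by omega)]; push_cast; ring
  have h2 : Even (2 * j + 2 * n : ℤ) := by rw [Int.even_iff]; omega
  have h3 : ((2 * j + 2 * n - 2 * j : ℤ) : ℝ) * halfAngle n = Real.pi := by
    rw [← two_mul_halfAngle hn]; push_cast; ring
  rw [roofVertex_eq_frame j, h1, h3, roofRadius, if_pos h2, Real.cos_pi, Real.sin_pi]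
  congr 1 <;> ring

theorem roofVertex_top_left (j : ℕ) :
    roofVertex n t (n + 2 * j + 1 + 1) = frame (roofAngle n j) (-Real.tan (halfAngle n)) 1 := by
  have h1 : roofIndex n (n + 2 * j + 1 + 1) = 2 * j + 2 * n + 1 := by
    rw [roofIndex, if_neg (by omega)]; push_cast; ring
  have h2 : ¬ Even (2 * j + 2 * n + 1 : ℤ) := by rw [Int.even_iff]; omega
  have h3 : ((2 * j + 2 * n + 1 - 2 * j : ℤ) : ℝ) * halfAngle n = halfAngle n + Real.pi := by
    rw [← two_mul_halfAngle hn]; push_cast; ring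
  rw [roofVertex_eq_frame j, h1, h3, roofRadius, if_neg h2, Real.cos_add_pi, Real.sin_add_pi,
    mul_neg, mul_neg, inv_cos_mul_cos hn, inv_cos_mul_sin, neg_neg]

omit hn in
theorem side_cases {k : ℕ} (hk : k < 3 * n) :
    ∃ j < n, k = j ∨ k = n + 2 * j ∨ k = n + 2 * j + 1 := by
  rcases Nat.lt_or_ge k n with h | h
  · exact ⟨k, h, Or.inl rfl⟩
  · exact ⟨(k - n) / 2, by omega, by omega⟩

variable (ht : 0 < t) (htw : t * (2 + Real.tan (halfAngle n) * t) < Real.tan (halfAngle n))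
include ht htw

theorem slope_lt_tan : t < Real.tan (halfAngle n) := by
  have := tan_halfAngle_pos hn
  nlinarith [mul_pos this (mul_pos ht ht)]

omit htw in
theorem roofRadius_pos (m : ℤ) : 0 < roofRadius n t m := by
  rw [roofRadius]
  split_ifs
  · have := tan_halfAngle_pos hn
    positivity
  · exact inv_pos.2 (cos_halfAngle_pos hn)

omit ht in
-- The apex lies inside the circumscribed circle: `(1 + wt)² < 1 + w²` is exactly the condition `t(2
-- + wt) < w` that also keeps the Lorenz map inside the side.
theorem roofRadius_le (m : ℤ) : roofRadius n t m ≤ (Real.cos (halfAngle n))⁻¹ := by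
  rw [roofRadius]
  split_ifs
  · have hw := tan_halfAngle_pos hn
    have hc := cos_halfAngle_pos hn
    have h1 : (Real.cos (halfAngle n))⁻¹ ^ 2 = 1 + Real.tan (halfAngle n) ^ 2 := by
      rw [Real.tan_eq_sin_div_cos, div_pow]
      have := Real.sin_sq_add_cos_sq (halfAngle n)
      field_simp
      linarith
    refine le_of_lt (lt_of_pow_lt_pow_left₀ 2 (inv_nonneg.2 hc.le) ?_)
    rw [h1]
    nlinarith
  · exact le_rfl

theorem roofRadius_mul_lt {m : ℤ} {x y : ℝ} (hxy : x < y) (hy : 0 ≤ y) :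
    roofRadius n t m * x < (Real.cos (halfAngle n))⁻¹ * y := by
  have h1 := roofRadius_pos hn ht m
  have h2 := roofRadius_le hn htw m
  calc roofRadius n t m * x < roofRadius n t m * y := mul_lt_mul_of_pos_left hxy h1
    _ ≤ _ := mul_le_mul_of_nonneg_right h2 hy

/-- With directions counted from the apex, equality is the line of a roof side through its apex (`e
= 0`) and its corner (`e = 1`); other vertices lie strictly on the inner side. -/
theorem roofRadius_mul_cos_add_lt {m e : ℤ} (h0 : ¬ (4 * n : ℤ) ∣ e) (h1 : ¬ (4 * n : ℤ) ∣ e - 1) :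
    roofRadius n t m * (Real.cos (e * halfAngle n) + t * Real.sin (e * halfAngle n))
      < 1 + Real.tan (halfAngle n) * t := by
  have hs : 0 < Real.sin (halfAngle n) :=
    Real.sin_pos_of_pos_of_lt_pi (halfAngle_pos hn) (by linarith [halfAngle_lt hn, Real.pi_pos])
  have hc := cos_halfAngle_pos hn
  have := roofRadius_mul_lt hn ht htw (m := m)
    (cos_add_mul_sin_lt hn ht (slope_lt_tan hn ht htw) h0 h1) (by positivity)
  rw [mul_add (Real.cos (halfAngle n))⁻¹, inv_cos_mul_cos hn, mul_left_comm _ t,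
    inv_cos_mul_sin, mul_comm t (Real.tan _)] at this
  exact this

theorem isConvexPolygon_roofPolygon : IsConvexPolygon (roofPolygon n t) := by
  refine ⟨by omega, fun k i hik hik' => ?_⟩
  have hw := tan_halfAngle_pos hn
  have hrot := val_finRotate k
  rw [Ne, Fin.ext_iff] at hik hik'
  rw [hrot] at hik'
  rw [roofPolygon_vertices_finRotate hn]
  change 0 < cross (roofVertex n t (k + 1) - roofVertex n t k)
    (roofVertex n t i - roofVertex n t k)
  obtain ⟨k, hk⟩ := k
  obtain ⟨i, hi⟩ := i
  simp only at hik hik' ⊢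
  clear hrot
  obtain ⟨j, hj, hkj⟩ := side_cases hk
  -- Directions matter modulo `4n`, and the differences of indices that occur are too small to be
  -- nonzero multiples of it.
  have hnd : ∀ D : ℤ, -(4 * n : ℤ) < D → D < 4 * n → D ≠ 0 → ¬ (4 * n : ℤ) ∣ D :=
    fun D h1 h2 h3 h4 => h3 (Int.eq_zero_of_abs_lt_dvd h4 (abs_lt.2 ⟨h1, h2⟩))
  have hidx : roofIndex n i = if i < n then 2 * (i : ℤ) - 1 else i + n - 1 := rfl
  rw [roofVertex_eq_frame j i]
  set M := roofIndex n i
  rcases hkj with rfl | rfl | rfl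
  · rw [roofVertex_bottom_left hn hj, roofVertex_bottom_right hn hj, frame_sub, frame_sub,
      cross_frame]
    have hrot' : i ≠ k + 1 := by
      split_ifs at hik' <;> omega
    have h0 : ¬ (4 * n : ℤ) ∣ M - 2 * k := by
      refine hnd _ ?_ ?_ ?_ <;> split_ifs at hidx <;> omega
    have h1 : ¬ (4 * n : ℤ) ∣ M - 2 * k - 1 := by
      refine hnd _ ?_ ?_ ?_ <;> split_ifs at hidx <;> omega
    have h2 : ¬ (4 * n : ℤ) ∣ M - 2 * k + 1 := by
      refine hnd _ ?_ ?_ ?_ <;> split_ifs at hidx <;> omega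
    have := roofRadius_mul_lt hn ht htw (m := M) (cos_mul_halfAngle_lt hn h0 h1 h2)
      (cos_halfAngle_pos hn).le
    rw [inv_cos_mul_cos hn] at this
    nlinarith
  · rw [roofVertex_top_right hn, roofVertex_apex hn, frame_sub, frame_sub, cross_frame]
    have hrot' : i ≠ n + 2 * j + 1 := by
      split_ifs at hik' <;> omega
    have h0 : ¬ (4 * n : ℤ) ∣ 2 * n - (M - 2 * j) := by
      refine hnd _ ?_ ?_ ?_ <;> split_ifs at hidx <;> omega
    have h1 : ¬ (4 * n : ℤ) ∣ 2 * n - (M - 2 * j) - 1 := by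
      refine hnd _ ?_ ?_ ?_ <;> split_ifs at hidx <;> omega
    have h3 : ((2 * n - (M - 2 * j) : ℤ) : ℝ) * halfAngle n
        = Real.pi - (M - 2 * j : ℤ) * halfAngle n := by
      rw [← two_mul_halfAngle hn]; push_cast; ring
    have := roofRadius_mul_cos_add_lt hn ht htw (m := M) h0 h1
    rw [h3, Real.cos_pi_sub, Real.sin_pi_sub] at this
    nlinarith
  · rw [roofVertex_apex hn, roofVertex_top_left hn, frame_sub, frame_sub, cross_frame]
    have h0 : ¬ (4 * n : ℤ) ∣ M - 2 * j - 2 * n := by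
      refine hnd _ ?_ ?_ ?_ <;> split_ifs at hidx <;> omega
    have h1 : ¬ (4 * n : ℤ) ∣ M - 2 * j - 2 * n - 1 := by
      -- Vertex 0 has index `-1`, not `4n - 1`, so for the last side the difference would be exactly
      -- `-4n`; but then vertex 0 is its endpoint and is excluded.
      by_cases hi0 : i = 0
      · have hj' : n + 2 * j + 1 + 1 < 3 * n := by
          split_ifs at hik' <;> omega
        refine hnd _ ?_ ?_ ?_ <;> split_ifs at hidx <;> omega
      · have hrot' : i ≠ n + 2 * j + 1 + 1 := by
          split_ifs at hik' <;> omega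
        refine hnd _ ?_ ?_ ?_ <;> split_ifs at hidx <;> omega
    have h3 : ((M - 2 * j - 2 * n : ℤ) : ℝ) * halfAngle n
        = (M - 2 * j : ℤ) * halfAngle n - Real.pi := by
      rw [← two_mul_halfAngle hn]; push_cast; ring
    have := roofRadius_mul_cos_add_lt hn ht htw (m := M) h0 h1
    rw [h3, Real.cos_sub_pi, Real.sin_sub_pi] at this
    nlinarith

end Roof

/-! ### The slap map of the roof polygon -/

section RoofSlap

variable {n : ℕ} {t : ℝ}

/-- The index of the horizontal side of the `j`-th frame. -/
def bottomSide (j : Fin n) : Fin (3 * n) := ⟨j, by omega⟩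

/-- The index of the side of the `j`-th roof that descends to the right. -/
def rightSide (j : Fin n) : Fin (3 * n) := ⟨n + 2 * j, by omega⟩

/-- The index of the side of the `j`-th roof that descends to the left. -/
def leftSide (j : Fin n) : Fin (3 * n) := ⟨n + 2 * j + 1, by omega⟩

/-- The arc length parameter of the midpoint of the `j`-th horizontal side. -/
noncomputable def bottomCenter (n : ℕ) (t : ℝ) (j : Fin n) : ℝ :=
  sideStart (roofPolygon n t) (bottomSide j) + Real.tan (halfAngle n)

/-- The arc length parameter of the apex of the `j`-th roof. -/
noncomputable def roofApex (n : ℕ) (t : ℝ) (j : Fin n) : ℝ :=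
  sideStart (roofPolygon n t) (leftSide j)

theorem exists_side_eq (k : Fin (3 * n)) :
    ∃ j : Fin n, k = bottomSide j ∨ k = rightSide j ∨ k = leftSide j := by
  obtain ⟨j, hj, h⟩ := side_cases k.2
  refine ⟨⟨j, hj⟩, ?_⟩
  simpa only [Fin.ext_iff, bottomSide, rightSide, leftSide] using h

variable (hn : 2 ≤ n)
include hn

theorem vertices_bottomSide (j : Fin n) : (roofPolygon n t).vertices (bottomSide j)
    = frame (roofAngle n j) (-Real.tan (halfAngle n)) (-1) := roofVertex_bottom_left hn j.2

theorem vertices_finRotate_bottomSide (j : Fin n) :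
    (roofPolygon n t).vertices (finRotate _ (bottomSide j))
      = frame (roofAngle n j) (Real.tan (halfAngle n)) (-1) := by
  rw [roofPolygon_vertices_finRotate hn]
  exact roofVertex_bottom_right hn j.2

theorem vertices_rightSide (j : Fin n) : (roofPolygon n t).vertices (rightSide j)
    = frame (roofAngle n j) (Real.tan (halfAngle n)) 1 := roofVertex_top_right hn j

theorem vertices_finRotate_rightSide (j : Fin n) :
    (roofPolygon n t).vertices (finRotate _ (rightSide j))
      = frame (roofAngle n j) 0 (1 + Real.tan (halfAngle n) * t) := by
  rw [roofPolygon_vertices_finRotate hn]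
  exact roofVertex_apex hn j

theorem vertices_leftSide (j : Fin n) : (roofPolygon n t).vertices (leftSide j)
    = frame (roofAngle n j) 0 (1 + Real.tan (halfAngle n) * t) := roofVertex_apex hn j

theorem vertices_finRotate_leftSide (j : Fin n) :
    (roofPolygon n t).vertices (finRotate _ (leftSide j))
      = frame (roofAngle n j) (-Real.tan (halfAngle n)) 1 := by
  rw [roofPolygon_vertices_finRotate hn]
  exact roofVertex_top_left hn j

omit hn in
theorem bottom_sq : (Real.tan (halfAngle n) - -Real.tan (halfAngle n)) ^ 2 + ((-1 : ℝ) - -1) ^ 2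
    = (2 * Real.tan (halfAngle n)) ^ 2 := by ring

omit hn in
theorem right_sq : (0 - Real.tan (halfAngle n)) ^ 2
    + (1 + Real.tan (halfAngle n) * t - 1) ^ 2
    = (Real.tan (halfAngle n) * √(1 + t ^ 2)) ^ 2 := by
  rw [mul_pow, Real.sq_sqrt (by positivity)]; ring

omit hn in
theorem left_sq : (-Real.tan (halfAngle n) - 0) ^ 2
    + (1 - (1 + Real.tan (halfAngle n) * t)) ^ 2
    = (Real.tan (halfAngle n) * √(1 + t ^ 2)) ^ 2 := by
  rw [mul_pow, Real.sq_sqrt (by positivity)]; ring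

theorem sideLength_bottomSide (j : Fin n) :
    sideLength (roofPolygon n t) (bottomSide j) = 2 * Real.tan (halfAngle n) :=
  sideLength_frame (vertices_bottomSide hn j) (vertices_finRotate_bottomSide hn j)
    (by linarith [tan_halfAngle_pos hn]) bottom_sq

theorem roofSide_length_pos : 0 < Real.tan (halfAngle n) * √(1 + t ^ 2) :=
  mul_pos (tan_halfAngle_pos hn) (Real.sqrt_pos.2 (by positivity))

theorem sideLength_rightSide (j : Fin n) : sideLength (roofPolygon n t) (rightSide j)
    = Real.tan (halfAngle n) * √(1 + t ^ 2) :=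
  sideLength_frame (vertices_rightSide hn j) (vertices_finRotate_rightSide hn j)
    (roofSide_length_pos hn) right_sq

theorem sideLength_leftSide (j : Fin n) : sideLength (roofPolygon n t) (leftSide j)
    = Real.tan (halfAngle n) * √(1 + t ^ 2) :=
  sideLength_frame (vertices_leftSide hn j) (vertices_finRotate_leftSide hn j)
    (roofSide_length_pos hn) left_sq

theorem roofApex_eq (j : Fin n) : roofApex n t j
    = sideStart (roofPolygon n t) (rightSide j) + Real.tan (halfAngle n) * √(1 + t ^ 2) := by
  rw [← sideLength_rightSide hn]
  exact sideStart_succ rfl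

theorem sidePoint_bottomSide (j : Fin n) (x : ℝ) :
    sidePoint (roofPolygon n t) (bottomSide j) (bottomCenter n t j + x)
      = frame (roofAngle n j) x (-1) := by
  have hw := tan_halfAngle_pos hn
  rw [bottomCenter, add_assoc, sidePoint_frame (vertices_bottomSide hn j)
    (vertices_finRotate_bottomSide hn j) (by linarith) bottom_sq]
  congr 1 <;> field_simp <;> ring

/-- Counterclockwise, the roof is run from right to left, and a horizontal unit costs arc length
`√(1 + t ^ 2)`. -/
theorem sidePoint_rightSide (j : Fin n) (x : ℝ) :
    sidePoint (roofPolygon n t) (rightSide j) (roofApex n t j - √(1 + t ^ 2) * x)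
      = frame (roofAngle n j) x (1 + Real.tan (halfAngle n) * t - t * x) := by
  have hw := tan_halfAngle_pos hn
  have hs : 0 < √(1 + t ^ 2) := Real.sqrt_pos.2 (by positivity)
  rw [roofApex_eq hn, add_sub_assoc, sidePoint_frame (vertices_rightSide hn j)
    (vertices_finRotate_rightSide hn j) (roofSide_length_pos hn) right_sq]
  congr 1 <;> field_simp <;> ring

theorem sidePoint_leftSide (j : Fin n) (x : ℝ) :
    sidePoint (roofPolygon n t) (leftSide j) (roofApex n t j - √(1 + t ^ 2) * x)
      = frame (roofAngle n j) x (1 + Real.tan (halfAngle n) * t + t * x) := by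
  have hw := tan_halfAngle_pos hn
  have hs : 0 < √(1 + t ^ 2) := Real.sqrt_pos.2 (by positivity)
  rw [roofApex, sub_eq_add_neg, sidePoint_frame (vertices_leftSide hn j)
    (vertices_finRotate_leftSide hn j) (roofSide_length_pos hn) left_sq]
  congr 1 <;> field_simp <;> ring

theorem inwardNormal_bottomSide (j : Fin n) :
    inwardNormal (roofPolygon n t) (bottomSide j) = frame (roofAngle n j) 0 1 := by
  have hw := tan_halfAngle_pos hn
  rw [inwardNormal_frame (vertices_bottomSide hn j) (vertices_finRotate_bottomSide hn j)
    (by linarith) bottom_sq]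
  congr 1 <;> field_simp <;> ring

theorem smul_inwardNormal_rightSide (j : Fin n) (a : ℝ) :
    (√(1 + t ^ 2) * a) • inwardNormal (roofPolygon n t) (rightSide j)
      = frame (roofAngle n j) (-(t * a)) (-a) := by
  have hw := tan_halfAngle_pos hn
  have hs : 0 < √(1 + t ^ 2) := Real.sqrt_pos.2 (by positivity)
  rw [inwardNormal_frame (vertices_rightSide hn j) (vertices_finRotate_rightSide hn j)
    (roofSide_length_pos hn) right_sq, smul_frame]
  congr 1 <;> field_simp <;> ring

theorem smul_inwardNormal_leftSide (j : Fin n) (a : ℝ) :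
    (√(1 + t ^ 2) * a) • inwardNormal (roofPolygon n t) (leftSide j)
      = frame (roofAngle n j) (t * a) (-a) := by
  have hw := tan_halfAngle_pos hn
  have hs : 0 < √(1 + t ^ 2) := Real.sqrt_pos.2 (by positivity)
  rw [inwardNormal_frame (vertices_leftSide hn j) (vertices_finRotate_leftSide hn j)
    (roofSide_length_pos hn) left_sq, smul_frame]
  congr 1 <;> field_simp <;> ring

theorem bottomCenter_add_mem {j : Fin n} {x : ℝ}
    (hx : x ∈ Ioo (-Real.tan (halfAngle n)) (Real.tan (halfAngle n))) :
    bottomCenter n t j + x ∈ Ioo (sideStart (roofPolygon n t) (bottomSide j))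
      (sideStart (roofPolygon n t) (bottomSide j)
        + sideLength (roofPolygon n t) (bottomSide j)) := by
  rw [sideLength_bottomSide hn, bottomCenter]
  exact ⟨by linarith [hx.1], by linarith [hx.2]⟩

theorem roofApex_sub_mem_right {j : Fin n} {x : ℝ} (hx : x ∈ Ioo 0 (Real.tan (halfAngle n))) :
    roofApex n t j - √(1 + t ^ 2) * x ∈ sideInterval (roofPolygon n t) (rightSide j) := by
  have hs : 0 < √(1 + t ^ 2) := Real.sqrt_pos.2 (by positivity)
  rw [roofApex_eq hn, sideInterval, sideLength_rightSide hn]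
  exact ⟨by nlinarith [hx.2], by nlinarith [hx.1]⟩

theorem roofApex_sub_mem_left {j : Fin n} {x : ℝ} (hx : x ∈ Ioc (-Real.tan (halfAngle n)) 0) :
    roofApex n t j - √(1 + t ^ 2) * x ∈ sideInterval (roofPolygon n t) (leftSide j) := by
  have hs : 0 < √(1 + t ^ 2) := Real.sqrt_pos.2 (by positivity)
  rw [roofApex, sideInterval, sideLength_leftSide hn]
  exact ⟨by nlinarith [hx.2], by nlinarith [hx.1]⟩

theorem sideForm_bottomSide_pos {j : Fin n} {x y : ℝ} (hy : -1 < y) :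
    0 < sideForm (roofPolygon n t) (bottomSide j) (frame (roofAngle n j) x y) := by
  have hw := tan_halfAngle_pos hn
  rw [sideForm_frame (vertices_bottomSide hn j) (vertices_finRotate_bottomSide hn j)]
  nlinarith

/-- The position over the `j`-th horizontal side of a point of the `j`-th roof, together with its
side. -/
theorem exists_roof_side (j : Fin n) (ht : 0 < t) {x : ℝ}
    (hx : x ∈ Ioo (-Real.tan (halfAngle n)) (Real.tan (halfAngle n))) :
    ∃ i y, (i = rightSide j ∨ i = leftSide j) ∧ 1 ≤ y ∧
      roofApex n t j - √(1 + t ^ 2) * x ∈ sideInterval (roofPolygon n t) i ∧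
      sidePoint (roofPolygon n t) i (roofApex n t j - √(1 + t ^ 2) * x)
        = frame (roofAngle n j) x y ∧
      (√(1 + t ^ 2) * (1 + y)) • inwardNormal (roofPolygon n t) i
        = frame (roofAngle n j)
          (lorenz (1 + t ^ 2) (t * (2 + Real.tan (halfAngle n) * t)) x - x) (-1 - y) := by
  -- The apex `x = 0` is the first endpoint of the left side, in agreement with the branch `x ≤ 0`
  -- of the Lorenz map. On the left `y = 1 + wt + tx`, so a drop of `1 + y` shifts the point by `t(1
  -- + y) = t²x + t(2 + wt)`.
  rcases le_or_gt x 0 with h | h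
  · refine ⟨leftSide j, _, Or.inr rfl, ?_, roofApex_sub_mem_left hn ⟨hx.1, h⟩,
      sidePoint_leftSide hn j x, ?_⟩
    · nlinarith [hx.1]
    · rw [smul_inwardNormal_leftSide hn, lorenz_of_nonpos h]
      congr 1 <;> ring
  · refine ⟨rightSide j, _, Or.inl rfl, ?_, roofApex_sub_mem_right hn ⟨h, hx.2⟩,
      sidePoint_rightSide hn j x, ?_⟩
    · nlinarith [hx.2]
    · rw [smul_inwardNormal_rightSide hn, lorenz_of_pos h]
      congr 1 <;> ring

variable (ht : 0 < t) (htw : t * (2 + Real.tan (halfAngle n) * t) < Real.tan (halfAngle n))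
include ht htw

/-- Both halves of the motion are chords with an end in the interior of a kept side; the descending
one lands there because `t(2 + wt) < w`. Only vertex parameters escape the description. -/
theorem isLorenzSystem_slapMap : IsLorenzSystem (slapMap (roofPolygon n t))
    (perimeter (roofPolygon n t)) (1 + t ^ 2) (t * (2 + Real.tan (halfAngle n) * t))
    (Real.tan (halfAngle n)) √(1 + t ^ 2) (bottomCenter n t) (roofApex n t) := by
  have hP := isConvexPolygon_roofPolygon hn ht htw
  have hw := tan_halfAngle_pos hn
  have hs : 0 < √(1 + t ^ 2) := Real.sqrt_pos.2 (by positivity)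
  have hinter : ∀ {j : Fin n} {x : ℝ},
      x ∈ Ioo (-Real.tan (halfAngle n)) (Real.tan (halfAngle n)) →
      bottomCenter n t j + x ∈ sideInterval (roofPolygon n t) (bottomSide j) :=
    fun hx => Ioo_subset_Ico_self (bottomCenter_add_mem hn hx)
  refine ⟨hs, fun x hx => slapMap_eq_zero hx, slapMap_mem_Icc hP, ?_, ?_, ?_, ?_, ?_, ?_⟩
  · intro i x hx
    exact Ico_subset_Icc_self (sideInterval_subset _ (hinter hx))
  · intro j x hx
    obtain ⟨i, y, -, hy, hmem, hpt, -⟩ := exists_roof_side hn j ht hx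
    refine slapMap_eq_of_chord_start hP (bottomCenter_add_mem hn hx) hmem ?_
      (by linarith : (0 : ℝ) < 1 + y) ?_
    · rw [hpt]
      exact sideForm_bottomSide_pos hn (by linarith)
    · rw [hpt, sidePoint_bottomSide hn, inwardNormal_bottomSide hn, smul_frame, frame_add]
      congr 1 <;> ring
  · intro j x hx
    obtain ⟨i, y, -, hy, hmem, hpt, hnormal⟩ := exists_roof_side hn j ht hx
    have hF : lorenz (1 + t ^ 2) (t * (2 + Real.tan (halfAngle n) * t)) x
        ∈ Ioo (-Real.tan (halfAngle n)) (Real.tan (halfAngle n)) :=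
      IsLorenzSystem.lorenz_mem_Ioo (by nlinarith) htw (by nlinarith) hx
    refine slapMap_eq_of_chord_end hP (bottomCenter_add_mem hn hF) hmem ?_
      (mul_pos hs (by linarith : (0 : ℝ) < 1 + y)) ?_
    · rw [hpt]
      exact sideForm_bottomSide_pos hn (by linarith)
    · rw [hnormal, hpt, sidePoint_bottomSide hn, frame_add]
      congr 1 <;> ring
  · intro i j x hx y hy hxy
    have h := eq_of_mem_sideInterval (hinter (j := i) hx) (hxy ▸ hinter (j := j) hy)
    rw [Fin.ext_iff] at h ⊢
    exact h
  · intro i j x hx y hy hxy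
    obtain ⟨k, _, hk, -, hmem, -, -⟩ := exists_roof_side hn j ht hy
    have h := eq_of_mem_sideInterval (hinter (j := i) hx) (hxy ▸ hmem)
    have hi := i.2
    rw [Fin.ext_iff] at h
    rcases hk with rfl | rfl
    · change (i : ℕ) = n + 2 * j at h
      omega
    · change (i : ℕ) = n + 2 * j + 1 at h
      omega
  · refine ((Set.finite_range (sideStart (roofPolygon n t))).insert
      (perimeter (roofPolygon n t))).countable.mono ?_
    rintro z ⟨hz, hz'⟩
    by_contra hcon
    rw [mem_insert_iff, not_or] at hcon
    obtain ⟨k, hk⟩ := exists_mem_sideInterval ⟨hz.1, lt_of_le_of_ne hz.2 hcon.1⟩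
    have hlt : sideStart (roofPolygon n t) k < z :=
      lt_of_le_of_ne hk.1 fun h => hcon.2 ⟨k, h⟩
    have hgt := hk.2
    obtain ⟨j, rfl | rfl | rfl⟩ := exists_side_eq k
    · rw [sideLength_bottomSide hn] at hgt
      have hb : bottomCenter n t j
        = sideStart (roofPolygon n t) (bottomSide j) + Real.tan (halfAngle n) := rfl
      exact (hz' j (z - bottomCenter n t j) ⟨by linarith, by linarith⟩).1 (by ring)
    · rw [sideLength_rightSide hn] at hgt
      have hb := roofApex_eq (t := t) hn j
      refine (hz' j ((roofApex n t j - z) / √(1 + t ^ 2)) ⟨?_, ?_⟩).2 (by field_simp; ring)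
      · refine lt_trans (neg_lt_zero.2 hw) (div_pos (by linarith) hs)
      · rw [div_lt_iff₀ hs]
        linarith
    · rw [sideLength_leftSide hn] at hgt
      have hb : roofApex n t j = sideStart (roofPolygon n t) (leftSide j) := rfl
      refine (hz' j ((roofApex n t j - z) / √(1 + t ^ 2)) ⟨?_, ?_⟩).2 (by field_simp; ring)
      · rw [lt_div_iff₀ hs]
        linarith
      · rw [div_lt_iff₀ hs]
        nlinarith

end RoofSlap

/-- Roofs of arbitrarily small slope for which the Lorenz map renormalises to the doubling map. -/
theorem exists_roof_slope {n : ℕ} (hn : 2 ≤ n) : ∃ (t : ℝ) (m : ℕ), 0 < t ∧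
    t * (2 + Real.tan (halfAngle n) * t) < Real.tan (halfAngle n) ∧ (1 + t ^ 2) ^ 2 ^ m = 2 := by
  have hw := tan_halfAngle_pos hn
  set w := Real.tan (halfAngle n)
  -- If `t < δ`, then `t(2 + wt) ≤ t(2 + w) < w`. The slope `lam` is taken below `1 + δ ^ 2`, so
  -- that `t = √(lam - 1) < δ`.
  set δ := min 1 (w / (2 + w))
  have hδ : 0 < δ := lt_min one_pos (by positivity)
  obtain ⟨lam, m, h1, h2, h3⟩ := exists_pow_two_pow_eq_two (pow_pos hδ 2)
  have hsq : √(lam - 1) ^ 2 = lam - 1 := Real.sq_sqrt (by linarith)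
  have ht : 0 < √(lam - 1) := Real.sqrt_pos.2 (by linarith)
  have htδ : √(lam - 1) < δ := lt_of_pow_lt_pow_left₀ 2 hδ.le (by rw [hsq]; linarith)
  have ht1 : √(lam - 1) < 1 := htδ.trans_le (min_le_left _ _)
  have ht2 : √(lam - 1) * (2 + w) < w :=
    (lt_div_iff₀ (by positivity)).1 (htδ.trans_le (min_le_right _ _))
  refine ⟨√(lam - 1), m, ht, ?_, ?_⟩
  · nlinarith [mul_pos ht hw]
  · rw [hsq, add_sub_cancel]
    exact h3

end SlapMap

theorem mainTheorem3 (n : ℕ) (hn : 2 ≤ n) :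
    ∃ P : Polygon SlapMap.Plane (3 * n), SlapMap.IsConvexPolygon P ∧
      {μ : MeasureTheory.Measure ℝ | SlapMap.IsErgodicAcip P μ}.encard = (n : ℕ∞) ∧
      ∀ μ : MeasureTheory.Measure ℝ, SlapMap.IsErgodicAcip P μ →
        ∃ k : ℕ, Even k ∧ SlapMap.HasMixingPeriod (SlapMap.slapMap P) μ k := by
  obtain ⟨t, m, ht, htw, hm⟩ := SlapMap.exists_roof_slope hn
  have hw := SlapMap.tan_halfAngle_pos hn
  have H := SlapMap.isLorenzSystem_slapMap hn ht htw
  have hlam : 1 < 1 + t ^ 2 := by nlinarith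
  have hc : 0 < t * (2 + Real.tan (SlapMap.halfAngle n) * t) := by positivity
  -- This is `t²w < 2t + t²w`: orbits drift from the ends of a side towards `(-c, c]` for every
  -- positive slope.
  have hslope : (1 + t ^ 2 - 1) * Real.tan (SlapMap.halfAngle n)
      < t * (2 + Real.tan (SlapMap.halfAngle n) * t) := by nlinarith
  have hiff : ∀ μ, SlapMap.IsErgodicAcip (SlapMap.roofPolygon n t) μ ↔ _ := fun μ =>
    Iff.trans ⟨fun h => ⟨h.1, h.2, h.3⟩, fun h => ⟨h.1, h.2.1, h.2.2⟩⟩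
      (H.isErgodicAcip_iff hlam hc htw hslope hm μ)
  refine ⟨SlapMap.roofPolygon n t, SlapMap.isConvexPolygon_roofPolygon hn ht htw, ?_, ?_⟩
  · have : {μ : MeasureTheory.Measure ℝ | SlapMap.IsErgodicAcip (SlapMap.roofPolygon n t) μ} = _ :=
      Set.ext hiff
    rw [this, ← Set.image_univ,
      (H.injective_towerMeasure hlam hc htw hslope hm).injOn.encard_image, Set.encard_univ]
    simp
  · intro μ hμ
    obtain ⟨i, rfl⟩ := (hiff μ).1 hμ
    exact ⟨2 * 2 ^ m, even_two_mul _, (H.isDoublingTower hlam hc htw hslope hm i).hasMixingPeriod⟩
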